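/- Let $I=[0,1]$ with Lebesgue measure $\lambda$ and $L^1=L^1(I,\lambda)$. For $f\in L^1$ let $Vf$ be the infimum of the total variations of the functions equal to $f$ a.e., let $BV=\{f\in L^1: Vf<\infty\}$ (complex valued) and $\|f\|_{BV}=Vf+\|f\|_1$. Let $T:I\to I$ be measurable and nonsingular, and let $P$ be its Perron–Frobenius operator, i.e. $\int_E Pf\,d\lambda=\int_{T^{-1}E}f\,d\lambda$ for all Borel sets $E$. Assume that $\alpha_0>0$, $B_0\ge 0$ and $$VPf\le \alpha_0Vf+B_0\|f\|_1\qquad\text{for all } f\in BV .$$ Put $\alpha=3\alpha_0$, $B=\frac{1-\alpha_0+B_0}{1-\alpha}$, $D=3+B$, $\Gamma=\max\{1+\alpha_0,B_0\}$, let $0<\ell<1-\alpha$ (in particular $\alpha_0<1/3$) and $r=1-\ell$. For a finite partition $\eta$ of $I$ into intervals let $\mathrm{mesh}(\eta)$ be the maximal length of its elements, $\Pi_\eta$ the conditional expectation on the $\sigma$-algebra generated by $\eta$, and $P_\eta=\Pi_\eta P\,\Pi_\eta$ (Ulam's approximation, acting on $BV$). For $\delta>0$ let $V_{\delta,r}(P_\eta)=\{z\in\mathbb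 C:|z|\le r\text{ or }\mathrm{dist}(z,\sigma(P_\eta))\le\delta\}$, $$H^*_{\delta,r}(P_\eta)=\sup\Big\{\Big(\tfrac{B_0}{r-\alpha_0}+1\Big)\|(z-P_\eta)^{-1}v\|_1+\tfrac1{r-\alpha_0}+\tfrac2r:\ v\in BV,\ \|v\|_1=1,\ z\in\mathbb C\setminus V_{\delta,r}(P_\eta)\Big\},$$ $n_1=\big\lceil\frac{\ln 2}{\ln (r/\alpha)}\big\rceil$, $C=r^{-n_1}$, $n_2=\big\lceil\frac{\ln (8BDC\,H^*_{\delta,r}(P_\eta))}{\ln (r/\alpha)}\big\rceil$, $\gamma=\frac{\ln(r/\alpha)}{\ln(1/\alpha)}$, and $$\varepsilon_0^*(P_\eta,\delta,r)=\min\Big\{\frac{r^{n_1+n_2}}{8B\big(H^*_{\delta,r}(P_\eta)B+\frac1{1-r}\big)},\ \Big[\frac{r^{n_1}}{4B\big(H^*_{\delta,r}(P_\eta)(D+B)+2(1+B)+\frac1{1-r}\big)}\Big]^{\gamma}\Big\}.$$ Consider the following algorithm. Start with some $k\in\mathbb N$, $k\ge1$, with $\delta=\frac1k<\ell$, and some partition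 $\eta$. (a) If $\mathrm{mesh}(\eta)\le(2\Gamma)^{-1}\varepsilon_0^*(P_\eta,\delta,r)$ fails, replace $\eta$ by a partition of smaller mesh and repeat (a). (b) Otherwise, check that each eigenvalue $\rho$ of $P_\eta$ with $|\rho|>r$ and $\rho\notin B(1,\delta)$ satisfies $\overline B(\rho,\delta)\cap\overline B(1,\delta)=\emptyset$. If this fails, replace $k$ by $2k$ (so $\delta=\frac1k$ is halved), keep $\eta$ and go to (a). If it holds, stop and report $\varepsilon_{com}=\mathrm{mesh}(\eta)$ and $\delta_{com}=\delta$. Let $\varepsilon_{com},\delta_{com}$ be reported by some run of this algorithm. Let $H\subset I$ be a (relatively) open, possibly empty, interval, let $P_Hf=P(f\chi_{I\setminus H})$ be the transfer operator of $T$ with the hole $H$, and assume $\lambda(H)\le\Gamma\varepsilon_{com}$. Then there are $e_H\in(0,1]$ and $f_H^*\in BV$ with $f_H^*\ge0$, $\int f_H^*\,d\lambda=1$ such that: 1. $P_Hf_H^*=e_Hf_H^*$, and $e_H$ is the spectral radius of $P_H:BV\to BV$. Either $e_H<1$, so that $f^*_H\,d\lambda$ is an absolutely continuous conditionally invariant measure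 (accim) with escape rate $-\ln e_H$, or $e_H=1$, $f^*_H=0$ a.e. on $H$ and $Pf_H^*=f_H^*$ (no mass escapes); 2. $1-e_H<\delta_{com}$; 3. $1-e_H\le\Big(1+\dfrac{2\alpha_0+B_0}{1-\ell-\alpha}\Big)\lambda(H)$. -/

import Mathlib

open MeasureTheory Set
open scoped ENNReal NNReal

noncomputable section

namespace AccimUlam

/-! ### The space `L¹([0,1])` and the transfer operator of a nonsingular map -/

/-- Complex `L¹` of `[0,1]` with Lebesgue measure. -/
abbrev L1 : Type := Lp ℂ 1 (volume : Measure unitInterval)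

lemma L1.integrable (f : L1) : Integrable (f : unitInterval → ℂ) volume :=
  L1.integrable_coeFn f

lemma L1.ext_setIntegral {f g : L1}
    (h : ∀ E : Set unitInterval, MeasurableSet E → ∫ x in E, f x = ∫ x in E, g x) : f = g := by
  apply Lp.ext
  exact (L1.integrable f).ae_eq_of_forall_setIntegral_eq _ _ (L1.integrable g)
    fun E hE _ => h E hE

/-- Real Radon–Nikodym step used for the existence of the transfer operator. -/
lemma exists_transfer_real {T : unitInterval → unitInterval}
    (hT : Measure.QuasiMeasurePreserving T volume volume)
    {u : unitInterval → ℝ} (hu : Integrable u volume) :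
    ∃ w : unitInterval → ℝ, Integrable w volume ∧ ∀ E : Set unitInterval, MeasurableSet E →
      ∫ x in E, w x = ∫ x in T ⁻¹' E, u x := by
  set s : SignedMeasure unitInterval := (volume.withDensityᵥ u).map T with hs
  have hac : s ≪ᵥ (volume : Measure unitInterval).toENNRealVectorMeasure := by
    refine VectorMeasure.AbsolutelyContinuous.mk fun E hE h0 => ?_
    rw [Measure.toENNRealVectorMeasure_apply_measurable hE] at h0
    rw [hs, VectorMeasure.map_apply _ hT.measurable hE,
      withDensityᵥ_apply hu (hT.measurable hE),
      Measure.restrict_eq_zero.2 (hT.preimage_null h0), integral_zero_measure]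
  refine ⟨s.rnDeriv volume, SignedMeasure.integrable_rnDeriv _ _, fun E hE => ?_⟩
  rw [← withDensityᵥ_apply (SignedMeasure.integrable_rnDeriv _ _) hE,
    SignedMeasure.withDensityᵥ_rnDeriv_eq s _ hac, hs, VectorMeasure.map_apply _ hT.measurable hE,
    withDensityᵥ_apply hu (hT.measurable hE)]

lemma exists_transfer {T : unitInterval → unitInterval}
    (hT : Measure.QuasiMeasurePreserving T volume volume) (f : L1) :
    ∃ g : L1, ∀ E : Set unitInterval, MeasurableSet E →
      ∫ x in E, g x = ∫ x in T ⁻¹' E, f x := by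
  obtain ⟨w₁, hw₁, h₁⟩ := exists_transfer_real hT (L1.integrable f).re
  obtain ⟨w₂, hw₂, h₂⟩ := exists_transfer_real hT (L1.integrable f).im
  have hw : Integrable (fun x => (w₁ x : ℂ) + (w₂ x : ℂ) * Complex.I) volume :=
    hw₁.ofReal.add (hw₂.ofReal.mul_const _)
  refine ⟨hw.toL1 _, fun E hE => ?_⟩
  have e1 : ∫ x in E, (hw.toL1 _ : L1) x = ∫ x in E, ((w₁ x : ℂ) + (w₂ x : ℂ) * Complex.I) :=
    integral_congr_ae (ae_restrict_of_ae hw.coeFn_toL1)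
  have e2 : ∫ x in T ⁻¹' E, f x
      = ((∫ x in T ⁻¹' E, (f x).re : ℝ) : ℂ) + ((∫ x in T ⁻¹' E, (f x).im : ℝ) : ℂ) * Complex.I :=
    (integral_re_add_im (𝕜 := ℂ) (L1.integrable f).integrableOn).symm
  have h₁' := h₁ E hE
  have h₂' := h₂ E hE
  simp only [RCLike.re_to_complex, RCLike.im_to_complex] at h₁' h₂'
  have i1 : Integrable (fun x => (w₁ x : ℂ)) (volume.restrict E) := hw₁.ofReal.integrableOn
  have i2 : Integrable (fun x => (w₂ x : ℂ) * Complex.I) (volume.restrict E) :=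
    (hw₂.ofReal.mul_const _).integrableOn
  rw [e1, e2, integral_add i1 i2, integral_mul_const, ← h₁', ← h₂']
  congr 1
  · exact integral_ofReal
  · congr 1
    exact integral_ofReal

/-- The value of the Perron–Frobenius operator: the unique `g ∈ L¹` with
`∫_E g dλ = ∫_{T⁻¹E} f dλ` for all measurable `E`. -/
def transferFun {T : unitInterval → unitInterval}
    (hT : Measure.QuasiMeasurePreserving T volume volume) (f : L1) : L1 :=
  (exists_transfer hT f).choose

lemma transferFun_spec {T : unitInterval → unitInterval}
    (hT : Measure.QuasiMeasurePreserving T volume volume) (f : L1)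
    {E : Set unitInterval} (hE : MeasurableSet E) :
    ∫ x in E, transferFun hT f x = ∫ x in T ⁻¹' E, f x :=
  (exists_transfer hT f).choose_spec E hE

lemma setIntegral_add_L1 (f g : L1) (E : Set unitInterval) :
    ∫ x in E, (f + g : L1) x = (∫ x in E, f x) + ∫ x in E, g x := by
  rw [← integral_add (L1.integrable f).integrableOn (L1.integrable g).integrableOn]
  exact integral_congr_ae (ae_restrict_of_ae (Lp.coeFn_add f g))

lemma setIntegral_smul_L1 (c : ℂ) (f : L1) (E : Set unitInterval) :
    ∫ x in E, (c • f : L1) x = c * ∫ x in E, f x := by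
  rw [← integral_const_mul]
  exact integral_congr_ae (ae_restrict_of_ae (Lp.coeFn_smul c f))

/-- `f ↦ ∫_E f dλ` as a continuous linear functional on `L¹`. -/
def setIntegralCLM (E : Set unitInterval) : L1 →L[ℂ] ℂ :=
  LinearMap.mkContinuous
    { toFun := fun f => ∫ x in E, f x
      map_add' := fun f g => setIntegral_add_L1 f g E
      map_smul' := fun c f => by simpa using setIntegral_smul_L1 c f E } 1 fun f => by
    change ‖∫ x in E, f x‖ ≤ 1 * ‖f‖
    rw [one_mul, L1.norm_eq_integral_norm]
    exact (norm_integral_le_integral_norm _).trans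
      (setIntegral_le_integral (L1.integrable f).norm (Filter.Eventually.of_forall fun x => norm_nonneg _))

/-- The Perron–Frobenius operator as a linear map. -/
def transferLin {T : unitInterval → unitInterval}
    (hT : Measure.QuasiMeasurePreserving T volume volume) : L1 →ₗ[ℂ] L1 where
  toFun := transferFun hT
  map_add' f g := L1.ext_setIntegral fun E hE => by
    rw [setIntegral_add_L1, transferFun_spec hT _ hE, transferFun_spec hT _ hE,
      transferFun_spec hT _ hE, setIntegral_add_L1]
  map_smul' c f := L1.ext_setIntegral fun E hE => by
    rw [RingHom.id_apply, setIntegral_smul_L1, transferFun_spec hT _ hE,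
      transferFun_spec hT _ hE, setIntegral_smul_L1]

lemma transferLin_closed {T : unitInterval → unitInterval}
    (hT : Measure.QuasiMeasurePreserving T volume volume) (u : ℕ → L1) (x y : L1)
    (hu : Filter.Tendsto u Filter.atTop (nhds x))
    (hy : Filter.Tendsto (transferLin hT ∘ u) Filter.atTop (nhds y)) : y = transferLin hT x := by
  refine L1.ext_setIntegral fun E hE => ?_
  have h1 := ((setIntegralCLM E).continuous.tendsto y).comp hy
  have h2 := ((setIntegralCLM (T ⁻¹' E)).continuous.tendsto x).comp hu
  have h3 : ((setIntegralCLM E) ∘ (transferLin hT ∘ u)) = (setIntegralCLM (T ⁻¹' E)) ∘ u := by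
    funext n
    exact transferFun_spec hT (u n) hE
  rw [h3] at h1
  exact (tendsto_nhds_unique h1 h2).trans (transferFun_spec hT x hE).symm

/-- The Perron–Frobenius operator `P : L¹ → L¹` of a nonsingular map `T`. -/
def transfer {T : unitInterval → unitInterval}
    (hT : Measure.QuasiMeasurePreserving T volume volume) : L1 →L[ℂ] L1 :=
  ContinuousLinearMap.ofSeqClosedGraph (g := transferLin hT) (transferLin_closed hT)

lemma transfer_spec {T : unitInterval → unitInterval}
    (hT : Measure.QuasiMeasurePreserving T volume volume) (f : L1)
    {E : Set unitInterval} (hE : MeasurableSet E) :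
    ∫ x in E, transfer hT f x = ∫ x in T ⁻¹' E, f x :=
  transferFun_spec hT f hE

/-- Multiplication by the indicator of `s`, `f ↦ f χ_s`, on `L¹`. -/
def cutoff {s : Set unitInterval} (hs : MeasurableSet s) : L1 →L[ℂ] L1 :=
  LinearMap.mkContinuous
    { toFun := fun f => ((L1.integrable f).indicator hs).toL1 _
      map_add' := fun f g => by
        apply Lp.ext
        filter_upwards [((L1.integrable (f + g)).indicator hs).coeFn_toL1,
          ((L1.integrable f).indicator hs).coeFn_toL1, ((L1.integrable g).indicator hs).coeFn_toL1,
          Lp.coeFn_add f g, Lp.coeFn_add (((L1.integrable f).indicator hs).toL1 _)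
            (((L1.integrable g).indicator hs).toL1 _)] with x h1 h2 h3 h4 h5
        rw [h1, h5, Pi.add_apply, h2, h3]
        by_cases hx : x ∈ s
        · rw [indicator_of_mem hx, indicator_of_mem hx, indicator_of_mem hx, h4, Pi.add_apply]
        · rw [indicator_of_notMem hx, indicator_of_notMem hx, indicator_of_notMem hx, add_zero]
      map_smul' := fun c f => by
        apply Lp.ext
        filter_upwards [((L1.integrable (c • f)).indicator hs).coeFn_toL1,
          ((L1.integrable f).indicator hs).coeFn_toL1,
          Lp.coeFn_smul c f, Lp.coeFn_smul c (((L1.integrable f).indicator hs).toL1 _)]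
          with x h1 h2 h3 h4
        rw [h1, RingHom.id_apply, h4, Pi.smul_apply, h2]
        by_cases hx : x ∈ s
        · rw [indicator_of_mem hx, indicator_of_mem hx, h3, Pi.smul_apply]
        · rw [indicator_of_notMem hx, indicator_of_notMem hx, smul_zero] } 1 fun f => by
    change ‖((L1.integrable f).indicator hs).toL1 _‖ ≤ 1 * ‖f‖
    rw [one_mul]
    refine Lp.norm_le_norm_of_ae_le ?_
    filter_upwards [((L1.integrable f).indicator hs).coeFn_toL1] with x hx
    rw [hx]
    exact norm_indicator_le_norm_self _ _

lemma cutoff_coe {s : Set unitInterval} (hs : MeasurableSet s) (f : L1) :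
    (cutoff hs f : unitInterval → ℂ) =ᵐ[volume] s.indicator f :=
  ((L1.integrable f).indicator hs).coeFn_toL1

/-! ### Functions of bounded variation -/

/-- The variation `V f` of an `L¹` class: the infimum of `var g` over the representatives `g`. -/
def V (f : L1) : ℝ≥0∞ :=
  ⨅ (g : unitInterval → ℂ) (_ : g =ᵐ[volume] f), eVariationOn g univ

lemma V_le {f : L1} {g : unitInterval → ℂ} (hg : g =ᵐ[volume] f) : V f ≤ eVariationOn g univ :=
  iInf₂_le g hg

lemma exists_of_V_lt {f : L1} {c : ℝ≥0∞} (h : V f < c) :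
    ∃ g : unitInterval → ℂ, g =ᵐ[volume] f ∧ eVariationOn g univ < c := by
  simpa [V, iInf_lt_iff] using h

lemma eVariationOn_add_le (f g : unitInterval → ℂ) :
    eVariationOn (f + g) univ ≤ eVariationOn f univ + eVariationOn g univ := by
  refine iSup_le fun p => ?_
  calc ∑ i ∈ Finset.range p.1, edist ((f + g) (p.2.1 (i + 1))) ((f + g) (p.2.1 i))
      ≤ ∑ i ∈ Finset.range p.1, (edist (f (p.2.1 (i + 1))) (f (p.2.1 i))
          + edist (g (p.2.1 (i + 1))) (g (p.2.1 i))) :=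
        Finset.sum_le_sum fun i _ => edist_add_add_le _ _ _ _
    _ ≤ _ := by
        rw [Finset.sum_add_distrib]
        exact add_le_add (le_iSup_of_le p le_rfl) (le_iSup_of_le p le_rfl)

lemma eVariationOn_const_smul_le (c : ℂ) (f : unitInterval → ℂ) :
    eVariationOn (c • f) univ ≤ ‖c‖ₑ * eVariationOn f univ := by
  refine iSup_le fun p => ?_
  calc ∑ i ∈ Finset.range p.1, edist ((c • f) (p.2.1 (i + 1))) ((c • f) (p.2.1 i))
      = ‖c‖ₑ * ∑ i ∈ Finset.range p.1, edist (f (p.2.1 (i + 1))) (f (p.2.1 i)) := by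
        rw [Finset.mul_sum]
        refine Finset.sum_congr rfl fun i _ => ?_
        rw [Pi.smul_apply, Pi.smul_apply, edist_smul₀, ENNReal.smul_def, smul_eq_mul, enorm_eq_nnnorm]
    _ ≤ _ := by
        gcongr
        exact le_iSup_of_le p le_rfl

lemma V_zero : V 0 = 0 := by
  refine le_antisymm ((V_le (g := 0) (Lp.coeFn_zero ℂ 1 volume).symm).trans ?_) bot_le
  exact (eVariationOn.constant_on (f := (0 : unitInterval → ℂ)) (by
    rintro _ ⟨x, -, rfl⟩ _ ⟨y, -, rfl⟩; rfl)).le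

lemma V_add_le (f g : L1) : V (f + g) ≤ V f + V g := by
  refine ENNReal.le_of_forall_pos_le_add fun ε hε hfin => ?_
  have hf : V f < V f + (ε / 2 : ℝ≥0) := ENNReal.lt_add_right
    (ne_top_of_le_ne_top hfin.ne le_self_add) (by simpa using hε.ne')
  have hg : V g < V g + (ε / 2 : ℝ≥0) := ENNReal.lt_add_right
    (ne_top_of_le_ne_top hfin.ne le_add_self) (by simpa using hε.ne')
  obtain ⟨u, hu, hu'⟩ := exists_of_V_lt hf
  obtain ⟨w, hw, hw'⟩ := exists_of_V_lt hg
  calc V (f + g) ≤ eVariationOn (u + w) univ := V_le ((hu.add hw).trans (Lp.coeFn_add f g).symm)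
    _ ≤ (V f + (ε / 2 : ℝ≥0)) + (V g + (ε / 2 : ℝ≥0)) :=
        (eVariationOn_add_le u w).trans (add_le_add hu'.le hw'.le)
    _ = V f + V g + ε := by
        rw [add_add_add_comm, ← ENNReal.coe_add, add_halves]

lemma V_smul_le (c : ℂ) (f : L1) : V (c • f) ≤ ‖c‖ₑ * V f := by
  by_cases hc : c = 0
  · simp [hc, V_zero]
  rw [V, V, ENNReal.mul_iInf_of_ne (by simpa using hc) enorm_ne_top]
  refine le_iInf fun g => ?_
  rw [ENNReal.mul_iInf_of_ne (by simpa using hc) enorm_ne_top]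
  refine le_iInf fun hg => ?_
  exact (V_le ((hg.const_smul c).trans (Lp.coeFn_smul c f).symm)).trans
    (eVariationOn_const_smul_le c g)

lemma V_smul (c : ℂ) (f : L1) : V (c • f) = ‖c‖ₑ * V f := by
  refine le_antisymm (V_smul_le c f) ?_
  by_cases hc : c = 0
  · simp [hc]
  have h := V_smul_le c⁻¹ (c • f)
  rw [inv_smul_smul₀ hc] at h
  calc ‖c‖ₑ * V f ≤ ‖c‖ₑ * (‖c⁻¹‖ₑ * V (c • f)) := by gcongr
    _ = V (c • f) := by
      rw [← mul_assoc, ← enorm_mul, mul_inv_cancel₀ hc, enorm_one, one_mul]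

/-- The linear subspace of `L¹` of classes of finite variation. -/
def bvSubmodule : Submodule ℂ L1 where
  carrier := {f | V f ≠ ⊤}
  zero_mem' := by simp [V_zero]
  add_mem' {f g} hf hg := ne_top_of_le_ne_top (ENNReal.add_ne_top.2 ⟨hf, hg⟩) (V_add_le f g)
  smul_mem' c f hf := ne_top_of_le_ne_top (ENNReal.mul_ne_top enorm_ne_top hf) (V_smul_le c f)

/-- The space `BV` of functions of bounded variation on `[0,1]` (complex valued, so that spectra
can be taken). It carries the norm `V f + ‖f‖₁`, not the `L¹` norm. -/
def BV : Type := bvSubmodule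

namespace BV

instance : AddCommGroup BV := inferInstanceAs (AddCommGroup bvSubmodule)
instance : Module ℂ BV := inferInstanceAs (Module ℂ bvSubmodule)

/-- The inclusion of `BV` in `L¹`, as a linear map. -/
def toL1Lin : BV →ₗ[ℂ] L1 := bvSubmodule.subtype

lemma toL1Lin_injective : Function.Injective toL1Lin := Subtype.val_injective

lemma V_ne_top (f : BV) : V (toL1Lin f) ≠ ⊤ := f.2

instance : Norm BV := ⟨fun f => (V (toL1Lin f)).toReal + ‖toL1Lin f‖⟩

lemma norm_def (f : BV) : ‖f‖ = (V (toL1Lin f)).toReal + ‖toL1Lin f‖ := rfl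

lemma normCore : NormedSpace.Core ℂ BV where
  norm_nonneg f := add_nonneg ENNReal.toReal_nonneg (norm_nonneg _)
  norm_smul c f := by
    rw [norm_def, norm_def, map_smul, V_smul, norm_smul, ENNReal.toReal_mul, toReal_enorm, mul_add]
  norm_triangle f g := by
    rw [norm_def, norm_def, norm_def, map_add]
    have h1 := ENNReal.toReal_mono (ENNReal.add_ne_top.2 ⟨V_ne_top f, V_ne_top g⟩)
      (V_add_le (toL1Lin f) (toL1Lin g))
    rw [ENNReal.toReal_add (V_ne_top f) (V_ne_top g)] at h1
    have h2 := norm_add_le (toL1Lin f) (toL1Lin g)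
    linarith
  norm_eq_zero_iff f := by
    constructor
    · intro h
      rw [norm_def] at h
      have h0 : ‖toL1Lin f‖ = 0 := le_antisymm
        (by have := ENNReal.toReal_nonneg (a := V (toL1Lin f)); linarith) (norm_nonneg _)
      exact toL1Lin_injective (by rw [map_zero]; exact norm_eq_zero.1 h0)
    · rintro rfl
      rw [norm_def, map_zero, V_zero]
      simp

instance : NormedAddCommGroup BV := NormedAddCommGroup.ofCore normCore
instance : NormedSpace ℂ BV := NormedSpace.ofCore normCore

lemma norm_toL1Lin_le (f : BV) : ‖toL1Lin f‖ ≤ ‖f‖ := by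
  rw [norm_def]
  linarith [ENNReal.toReal_nonneg (a := V (toL1Lin f))]

/-- The inclusion of `BV` in `L¹`. -/
def toL1 : BV →L[ℂ] L1 :=
  toL1Lin.mkContinuous 1 fun f => by rw [one_mul]; exact norm_toL1Lin_le f

lemma norm_eq (f : BV) : ‖f‖ = (V (toL1 f)).toReal + ‖toL1 f‖ := rfl

lemma toL1_injective : Function.Injective toL1 := toL1Lin_injective

/-- An operator on `L¹` with `V (A f) ≤ a V f + b ‖f‖₁` on `BV` restricts to a bounded operator
on `BV`. -/
def restrictOp (A : L1 →L[ℂ] L1) (a b : ℝ)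
    (h : ∀ f : L1, V f ≠ ⊤ →
      V (A f) ≤ ENNReal.ofReal a * V f + ENNReal.ofReal b * ENNReal.ofReal ‖f‖) :
    BV →L[ℂ] BV :=
  LinearMap.mkContinuous
    { toFun := fun f => (⟨A (toL1 f), ne_top_of_le_ne_top (ENNReal.add_ne_top.2
        ⟨ENNReal.mul_ne_top ENNReal.ofReal_ne_top f.2,
          ENNReal.mul_ne_top ENNReal.ofReal_ne_top ENNReal.ofReal_ne_top⟩)
        (h (toL1 f) f.2)⟩ : bvSubmodule)
      map_add' := fun f g => toL1_injective (by
        change A (toL1 (f + g)) = A (toL1 f) + A (toL1 g)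
        rw [map_add, map_add])
      map_smul' := fun c f => toL1_injective (by
        change A (toL1 (c • f)) = c • A (toL1 f)
        rw [map_smul, map_smul]) } (max a 0 + max b 0 + ‖A‖) fun f => by
    rw [norm_eq]
    change (V (A (toL1 f))).toReal + ‖A (toL1 f)‖ ≤ _
    have h1 := ENNReal.toReal_mono (ENNReal.add_ne_top.2
      ⟨ENNReal.mul_ne_top ENNReal.ofReal_ne_top (V_ne_top f),
        ENNReal.mul_ne_top ENNReal.ofReal_ne_top ENNReal.ofReal_ne_top⟩) (h (toL1 f) f.2)
    rw [ENNReal.toReal_add (ENNReal.mul_ne_top ENNReal.ofReal_ne_top (V_ne_top f))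
      (ENNReal.mul_ne_top ENNReal.ofReal_ne_top ENNReal.ofReal_ne_top), ENNReal.toReal_mul,
      ENNReal.toReal_mul, ENNReal.toReal_ofReal', ENNReal.toReal_ofReal',
      ENNReal.toReal_ofReal (norm_nonneg _)] at h1
    have h2 := A.le_opNorm (toL1 f)
    have h3 : (V (toL1 f)).toReal ≤ ‖f‖ := by rw [norm_eq]; linarith [norm_nonneg (toL1 f)]
    have h4 : ‖toL1 f‖ ≤ ‖f‖ := norm_toL1Lin_le f
    have h5 : max a 0 * (V (toL1 f)).toReal ≤ max a 0 * ‖f‖ := by gcongr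
    have h6 : max b 0 * ‖toL1 f‖ ≤ max b 0 * ‖f‖ := by gcongr
    have h7 : ‖A‖ * ‖toL1 f‖ ≤ ‖A‖ * ‖f‖ := by gcongr
    have h8 : (V (toL1 f)).toReal = (V (toL1Lin f)).toReal := rfl
    rw [← h8] at h1
    linarith

lemma toL1_restrictOp (A : L1 →L[ℂ] L1) (a b : ℝ)
    (h : ∀ f : L1, V f ≠ ⊤ →
      V (A f) ≤ ENNReal.ofReal a * V f + ENNReal.ofReal b * ENNReal.ofReal ‖f‖) (f : BV) :
    toL1 (restrictOp A a b h f) = A (toL1 f) := rfl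

/-- An `L¹` class with a representative of finite variation, as an element of `BV`. -/
def mk (f : L1) (h : V f ≠ ⊤) : BV := (⟨f, h⟩ : bvSubmodule)

lemma toL1_mk (f : L1) (h : V f ≠ ⊤) : toL1 (mk f h) = f := rfl

end BV

/-! ### Indicators of intervals -/

lemma boundedVariationOn_indicator {J : Set unitInterval} (hJ : J.OrdConnected) :
    BoundedVariationOn (J.indicator (fun _ => (1 : ℂ))) univ := by
  classical
  set a : unitInterval → ℝ := fun x => if ∃ h ∈ J, h ≤ x then 1 else 0 with ha
  set b : unitInterval → ℝ := fun x => if (∃ h ∈ J, h ≤ x) ∧ x ∉ J then 1 else 0 with hb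
  have hb1 : ∀ x ∈ (univ : Set unitInterval), |a x| ≤ 1 := by
    intro x _
    simp only [ha]
    split_ifs <;> simp
  have hb2 : ∀ x ∈ (univ : Set unitInterval), |b x| ≤ 1 := by
    intro x _
    simp only [hb]
    split_ifs <;> simp
  have ma : MonotoneOn a univ := by
    intro x _ y _ hxy
    simp only [ha]
    split_ifs with h1 h2 <;> try norm_num
    obtain ⟨h, hh, hx⟩ := h1
    exact h2 ⟨h, hh, hx.trans hxy⟩
  have mb : MonotoneOn b univ := by
    intro x _ y _ hxy
    simp only [hb]
    split_ifs with h1 h2 <;> try norm_num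
    obtain ⟨⟨h, hh, hx⟩, hxJ⟩ := h1
    exact h2 ⟨⟨h, hh, hx.trans hxy⟩, fun hy => hxJ (hJ.out hh hy ⟨hx, hxy⟩)⟩
  have va := ma.boundedVariationOn hb1
  have vb := mb.boundedVariationOn hb2
  have va' : BoundedVariationOn (fun x => (a x : ℂ)) univ :=
    Complex.isometry_ofReal.lipschitz.comp_boundedVariationOn va
  have vb' : BoundedVariationOn (fun x => (b x : ℂ)) univ :=
    Complex.isometry_ofReal.lipschitz.comp_boundedVariationOn vb
  have e : J.indicator (fun _ => (1 : ℂ))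
      = (fun x => (a x : ℂ)) + (-1 : ℂ) • (fun x => (b x : ℂ)) := by
    funext x
    simp only [ha, hb, Pi.add_apply, Pi.smul_apply]
    by_cases hx : x ∈ J
    · have : ∃ h ∈ J, h ≤ x := ⟨x, hx, le_rfl⟩
      simp [hx, this]
    · by_cases h : ∃ h ∈ J, h ≤ x <;> simp [hx, h]
  rw [e]
  exact ne_top_of_le_ne_top (ENNReal.add_ne_top.2 ⟨va', ne_top_of_le_ne_top
    (ENNReal.mul_ne_top enorm_ne_top vb') (eVariationOn_const_smul_le _ _)⟩)
    (eVariationOn_add_le _ _)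

lemma boundedVariationOn_indicator_compl {J : Set unitInterval} (hJ : J.OrdConnected) :
    BoundedVariationOn (Jᶜ.indicator (fun _ => (1 : ℂ))) univ := by
  have e : Jᶜ.indicator (fun _ => (1 : ℂ))
      = (fun _ => (1 : ℂ)) + (-1 : ℂ) • J.indicator (fun _ => (1 : ℂ)) := by
    funext x
    by_cases hx : x ∈ J <;> simp [hx]
  have h1 : eVariationOn (fun _ : unitInterval => (1 : ℂ)) univ = 0 :=
    eVariationOn.constant_on (by rintro _ ⟨x, -, rfl⟩ _ ⟨y, -, rfl⟩; rfl)
  rw [e]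
  exact ne_top_of_le_ne_top (ENNReal.add_ne_top.2 ⟨by rw [h1]; exact ENNReal.zero_ne_top,
    ne_top_of_le_ne_top (ENNReal.mul_ne_top enorm_ne_top (boundedVariationOn_indicator hJ))
      (eVariationOn_const_smul_le _ _)⟩) (eVariationOn_add_le _ _)

/-- A representative is bounded by its variation plus the `L¹` norm. -/
lemma enorm_le_of_rep {f : L1} {g : unitInterval → ℂ} (hg : g =ᵐ[volume] f) (x : unitInterval) :
    ‖g x‖ₑ ≤ ENNReal.ofReal ‖f‖ + eVariationOn g univ := by
  have h1 : ENNReal.ofReal ‖f‖ = ∫⁻ y, ‖g y‖ₑ := by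
    rw [ofReal_norm, Lp.enorm_def, eLpNorm_one_eq_lintegral_enorm]
    exact lintegral_congr_ae (hg.mono fun y hy => by simp only [hy])
  calc ‖g x‖ₑ = ∫⁻ _ : unitInterval, ‖g x‖ₑ := by simp
    _ ≤ ∫⁻ y, (‖g y‖ₑ + eVariationOn g univ) := by
        refine lintegral_mono fun y => ?_
        calc ‖g x‖ₑ = ‖g y + (g x - g y)‖ₑ := by rw [add_sub_cancel]
          _ ≤ ‖g y‖ₑ + ‖g x - g y‖ₑ := enorm_add_le _ _
          _ ≤ ‖g y‖ₑ + eVariationOn g univ := by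
              gcongr
              rw [← edist_eq_enorm_sub]
              exact eVariationOn.edist_le g (mem_univ x) (mem_univ y)
    _ = _ := by rw [lintegral_add_right _ measurable_const, h1]; simp

lemma V_cutoff_le {s : Set unitInterval} (hs : MeasurableSet s)
    (hv : BoundedVariationOn (s.indicator (fun _ => (1 : ℂ))) univ) (f : L1) (hf : V f ≠ ⊤) :
    V (cutoff hs f) ≤
      ENNReal.ofReal (1 + (eVariationOn (s.indicator (fun _ => (1 : ℂ))) univ).toReal) * V f
      + ENNReal.ofReal (eVariationOn (s.indicator (fun _ => (1 : ℂ))) univ).toReal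
        * ENNReal.ofReal ‖f‖ := by
  set c := eVariationOn (s.indicator (fun _ => (1 : ℂ))) univ with hc
  rw [ENNReal.ofReal_add zero_le_one ENNReal.toReal_nonneg, ENNReal.ofReal_one,
    ENNReal.ofReal_toReal hv]
  have key : ∀ g : unitInterval → ℂ, g =ᵐ[volume] f →
      V (cutoff hs f) ≤ (1 + c) * eVariationOn g univ + c * ENNReal.ofReal ‖f‖ := by
    intro g hg
    have e : s.indicator (fun _ => (1 : ℂ)) • g = s.indicator g := by
      funext x
      by_cases hx : x ∈ s <;> simp [hx]
    have h1 : s.indicator g =ᵐ[volume] cutoff hs f := by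
      refine Filter.EventuallyEq.trans ?_ (cutoff_coe hs f).symm
      filter_upwards [hg] with x hx
      by_cases hxs : x ∈ s
      · rw [indicator_of_mem hxs, indicator_of_mem hxs, hx]
      · rw [indicator_of_notMem hxs, indicator_of_notMem hxs]
    refine (V_le h1).trans ?_
    rw [← e]
    refine (eVariationOn_smul_le (C := 1) (fun x _ => ?_)
      (fun x _ => enorm_le_of_rep hg x)).trans (le_of_eq ?_)
    · by_cases hx : x ∈ s <;> simp [hx]
    · rw [← hc]; ring
  have h2 : V (cutoff hs f) ≤ ⨅ (g : unitInterval → ℂ) (_ : g =ᵐ[volume] f),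
      ((1 + c) * eVariationOn g univ + c * ENNReal.ofReal ‖f‖) :=
    le_iInf₂ key
  refine ENNReal.le_of_forall_pos_le_add fun ε hε hfin => ?_
  have hc1 : (1 + c) ≠ ⊤ := ENNReal.add_ne_top.2 ⟨ENNReal.one_ne_top, hv⟩
  have hc0 : (1 + c) ≠ 0 := by simp
  obtain ⟨g, hg, hg'⟩ := exists_of_V_lt (f := f) (c := V f + ε / (1 + c))
    (ENNReal.lt_add_right hf (ENNReal.div_ne_zero.2 ⟨by simpa using hε.ne', hc1⟩))
  calc V (cutoff hs f) ≤ (1 + c) * eVariationOn g univ + c * ENNReal.ofReal ‖f‖ := key g hg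
    _ ≤ (1 + c) * (V f + ε / (1 + c)) + c * ENNReal.ofReal ‖f‖ := by gcongr
    _ = (1 + c) * V f + c * ENNReal.ofReal ‖f‖ + ε := by
        rw [mul_add, ENNReal.mul_div_cancel hc0 hc1]; ring

/-- The indicator `χ_J` of an interval `J`, as an element of `BV`. -/
def bvIndicator (J : Set unitInterval) (hJ : J.OrdConnected) : BV :=
  BV.mk (indicatorConstLp 1 hJ.measurableSet (measure_ne_top _ _) (1 : ℂ))
    (ne_top_of_le_ne_top (boundedVariationOn_indicator hJ) (V_le indicatorConstLp_coeFn.symm))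

/-! ### Closed system, Ulam approximation, open system -/

/-- The Lasota–Yorke inequality `V(Pf) ≤ α₀ V f + B₀ ‖f‖₁` for all `f ∈ BV`. -/
def LasotaYorke {T : unitInterval → unitInterval}
    (hT : Measure.QuasiMeasurePreserving T volume volume) (α₀ B₀ : ℝ) : Prop :=
  ∀ f : L1, V f ≠ ⊤ →
    V (transfer hT f) ≤ ENNReal.ofReal α₀ * V f + ENNReal.ofReal B₀ * ENNReal.ofReal ‖f‖

/-- The Perron–Frobenius operator as a bounded operator on `BV`. -/
def transferBV {T : unitInterval → unitInterval}
    (hT : Measure.QuasiMeasurePreserving T volume volume) {α₀ B₀ : ℝ}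
    (hA : LasotaYorke hT α₀ B₀) : BV →L[ℂ] BV :=
  BV.restrictOp (transfer hT) α₀ B₀ hA

/-- The transfer operator `P_H f = P (f χ_{X₀})`, `X₀ = [0,1] \ H`, of the map with hole `H`,
on `L¹`. -/
def openTransfer {T : unitInterval → unitInterval}
    (hT : Measure.QuasiMeasurePreserving T volume volume) {H : Set unitInterval}
    (hH : H.OrdConnected) : L1 →L[ℂ] L1 :=
  (transfer hT).comp (cutoff hH.measurableSet.compl)

/-- The transfer operator `P_H` of the map with hole `H`, as a bounded operator on `BV`. -/
def openTransferBV {T : unitInterval → unitInterval}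
    (hT : Measure.QuasiMeasurePreserving T volume volume) {α₀ B₀ : ℝ}
    (hA : LasotaYorke hT α₀ B₀) {H : Set unitInterval} (hH : H.OrdConnected) : BV →L[ℂ] BV :=
  (transferBV hT hA).comp (BV.restrictOp (cutoff hH.measurableSet.compl) _ _
    (V_cutoff_le hH.measurableSet.compl (boundedVariationOn_indicator_compl hH)))

lemma toL1_openTransferBV {T : unitInterval → unitInterval}
    (hT : Measure.QuasiMeasurePreserving T volume volume) {α₀ B₀ : ℝ}
    (hA : LasotaYorke hT α₀ B₀) {H : Set unitInterval} (hH : H.OrdConnected) (f : BV) :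
    BV.toL1 (openTransferBV hT hA hH f) = openTransfer hT hH (BV.toL1 f) := rfl

/-- `f` is a probability density: `f ≥ 0` almost everywhere and `∫ f dλ = 1`. -/
def IsDensity (f : L1) : Prop :=
  (∀ᵐ x, 0 ≤ (f x).re ∧ (f x).im = 0) ∧ ∫ x, f x = 1

/-- `f dλ` is an absolutely continuous conditionally invariant probability measure of the map with
hole `H`, with `P_H f = e f` and `0 < e < 1` (so the escape rate is `-ln e`). -/
def IsAccimDensity {T : unitInterval → unitInterval}
    (hT : Measure.QuasiMeasurePreserving T volume volume) {H : Set unitInterval}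
    (hH : H.OrdConnected) (e : ℝ) (f : L1) : Prop :=
  IsDensity f ∧ 0 < e ∧ e < 1 ∧ openTransfer hT hH f = (e : ℂ) • f

/-- A finite partition of `[0,1]` into (nonempty) intervals. -/
structure IntervalPartition where
  toFinpartition : Finpartition (univ : Set unitInterval)
  ordConnected : ∀ J ∈ toFinpartition.parts, J.OrdConnected

/-- The maximal length of the intervals of `η`. -/
def IntervalPartition.mesh (η : IntervalPartition) : ℝ :=
  (η.toFinpartition.parts.sup fun J => (volume J).toNNReal : ℝ≥0)

/-- The conditional expectation `Π_η f = ∑_J (λ(J)⁻¹ ∫_J f dλ) χ_J`. -/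
def ulamProj (η : IntervalPartition) : L1 →L[ℂ] BV :=
  ∑ J : η.toFinpartition.parts, (((volume.real J.1)⁻¹ : ℝ) : ℂ) •
    (setIntegralCLM J.1).smulRight (bvIndicator J.1 (η.ordConnected J.1 J.2))

/-- Ulam's approximation `P_η = Π_η ∘ P ∘ Π_η` on `BV`. -/
def ulam {T : unitInterval → unitInterval}
    (hT : Measure.QuasiMeasurePreserving T volume volume) (η : IntervalPartition) : BV →L[ℂ] BV :=
  (ulamProj η).comp ((transfer hT).comp (BV.toL1.comp ((ulamProj η).comp BV.toL1)))

/-! ### The quantities of the algorithm -/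

/-- `V_{δ,r}(A) = {z : |z| ≤ r or dist(z, σ(A)) ≤ δ}`. -/
def Vset (A : BV →L[ℂ] BV) (δ r : ℝ) : Set ℂ :=
  {z | ‖z‖ ≤ r ∨ Metric.infDist z (spectrum ℂ A) ≤ δ}

/-- `H*_{δ,r}(A)`, the supremum over `z ∉ V_{δ,r}(A)` and `‖v‖₁ = 1` of
`(B₀/(r-α₀) + 1) ‖(z-A)⁻¹ v‖₁ + 1/(r-α₀) + 2/r`. -/
def Hstar (A : BV →L[ℂ] BV) (α₀ B₀ δ r : ℝ) : ℝ :=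
  sSup {x | ∃ (z : ℂ) (v : BV), z ∉ Vset A δ r ∧ ‖BV.toL1 v‖ = 1 ∧
    x = (B₀ / (r - α₀) + 1) * ‖BV.toL1 (resolvent A z v)‖ + 1 / (r - α₀) + 2 / r}

/-- `ε₀*(A, δ, r)` with `α = 3 α₀`, `B = (1 - α₀ + B₀)/(1 - α)`, `D = 3 + B`,
`n₁ = ⌈ln 2 / ln (r/α)⌉`, `C = r^{-n₁}`, `n₂ = ⌈ln (8 B D C H*) / ln (r/α)⌉`,
`γ = ln (r/α) / ln (1/α)`. -/
def epsStar (A : BV →L[ℂ] BV) (α₀ B₀ δ r : ℝ) : ℝ :=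
  let α := 3 * α₀
  let B := (1 - α₀ + B₀) / (1 - α)
  let D := 3 + B
  let h := Hstar A α₀ B₀ δ r
  let n₁ : ℤ := ⌈Real.log 2 / Real.log (r / α)⌉
  let C := r ^ (-n₁)
  let n₂ : ℤ := ⌈Real.log (8 * B * D * C * h) / Real.log (r / α)⌉
  let γ := Real.log (r / α) / Real.log (1 / α)
  min (r ^ (n₁ + n₂) / (8 * B * (h * B + (1 - r)⁻¹)))
    ((r ^ n₁ / (4 * B * (h * (D + B) + 2 * (1 + B) + (1 - r)⁻¹))) ^ γ)

/-- `Γ = max {1 + α₀, B₀}`. -/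
def Gam (α₀ B₀ : ℝ) : ℝ := max (1 + α₀) B₀

/-- The first test of the algorithm: `mesh η ≤ (2Γ)⁻¹ ε₀*(P_η, δ, r)` for `r = 1 - ℓ`, `δ = 1/k`. -/
def MeshTest {T : unitInterval → unitInterval}
    (hT : Measure.QuasiMeasurePreserving T volume volume) (α₀ B₀ ℓ : ℝ) (k : ℕ)
    (η : IntervalPartition) : Prop :=
  η.mesh ≤ (2 * Gam α₀ B₀)⁻¹ * epsStar (ulam hT η) α₀ B₀ (1 / (k : ℝ)) (1 - ℓ)

/-- The second test of the algorithm: every eigenvalue `ρ` of `P_η` with `|ρ| > r = 1 - ℓ` that is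
not in `B(1,δ)`, `δ = 1/k`, satisfies that the closed discs of radius `δ` about `ρ` and about `1`
are disjoint. -/
def SeparationTest {T : unitInterval → unitInterval}
    (hT : Measure.QuasiMeasurePreserving T volume volume) (ℓ : ℝ) (k : ℕ)
    (η : IntervalPartition) : Prop :=
  ∀ ρ : ℂ, Module.End.HasEigenvalue (ulam hT η : BV →ₗ[ℂ] BV) ρ → 1 - ℓ < ‖ρ‖ →
    ρ ∉ Metric.ball (1 : ℂ) (1 / (k : ℝ)) →
    Disjoint (Metric.closedBall ρ (1 / (k : ℝ))) (Metric.closedBall (1 : ℂ) (1 / (k : ℝ)))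

/-- The states `(k, η)` that a run of the algorithm can reach: it starts from any `k` with
`1/k < ℓ` and any partition; if the first test fails, a partition of smaller mesh is fed in; if the
first test holds and the second one fails, `k` is doubled and the partition is kept. -/
inductive Reaches {T : unitInterval → unitInterval}
    (hT : Measure.QuasiMeasurePreserving T volume volume) (α₀ B₀ ℓ : ℝ) :
    ℕ → IntervalPartition → Prop
  | start (k : ℕ) (η : IntervalPartition) (hk : 0 < k) (hkl : 1 / (k : ℝ) < ℓ) :
      Reaches hT α₀ B₀ ℓ k η
  | refine (k : ℕ) (η η' : IntervalPartition) (h : Reaches hT α₀ B₀ ℓ k η)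
      (hfail : ¬ MeshTest hT α₀ B₀ ℓ k η) (hη : η'.mesh < η.mesh) : Reaches hT α₀ B₀ ℓ k η'
  | double (k : ℕ) (η : IntervalPartition) (h : Reaches hT α₀ B₀ ℓ k η)
      (hpass : MeshTest hT α₀ B₀ ℓ k η) (hfail : ¬ SeparationTest hT ℓ k η) :
      Reaches hT α₀ B₀ ℓ (2 * k) η

/-- `(εcom, δcom)` is an output of the algorithm for `T` and `ℓ`: a run reaches a state `(k, η)`
that passes both tests, and then `εcom = mesh η`, `δcom = 1/k` are reported. -/
def IsOutput {T : unitInterval → unitInterval}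
    (hT : Measure.QuasiMeasurePreserving T volume volume) (α₀ B₀ ℓ εcom δcom : ℝ) : Prop :=
  ∃ (k : ℕ) (η : IntervalPartition), Reaches hT α₀ B₀ ℓ k η ∧ MeshTest hT α₀ B₀ ℓ k η ∧
    SeparationTest hT ℓ k η ∧ εcom = η.mesh ∧ δcom = 1 / (k : ℝ)

end AccimUlam

end

open AccimUlam

/-!
The proof is direct: it does not compare the spectra of `P_η` and `P_H` by perturbation theory.
Put `r = 1 - ℓ`, `α = 3 α₀`, `c = 2 α₀ + B₀` and `K = c / (r - α)`.

*Dynamics.* Cutting along an interval adds at most `2 ‖f‖_∞` to the variation, so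
`V (P_H f) ≤ α V f + c ‖f‖₁` (`var_openTransferBV_le`). One step of `P_H` loses the mass
`∫_H f ≤ λ(H) (V f + ‖f‖₁)`. As soon as `(1 + K) λ(H) ≤ ℓ`, these two facts make the cone
`{f ≥ 0, V f ≤ K ‖f‖₁}` invariant, and on it `P_H` multiplies the mass by at least
`1 - (1 + K) λ(H)` (`cone_pow`). By Gelfand's formula this number bounds the spectral radius `e` from
below, so `e ≥ r > α`. A positive operator with a Lasota–Yorke inequality whose spectral radius `e`
exceeds the contraction rate `α` has a positive eigenvector for `e`
(`PositiveLY.exists_eigenvector`): the mass of `(t - P_H)⁻¹ 1` has to blow up as `t ↓ e`, for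
otherwise the Lasota–Yorke inequality would bound the resolvent near the whole spectral circle; the
normalised functions `(t - P_H)⁻¹ 1` have bounded variation, and Helly's theorem
(`exists_subseq_tendsto_L1`) yields a limit in `L¹`, which is the eigenvector.

*Algorithm.* It remains to see that the first test of the algorithm forces `(1 + K) λ(H) < δ < ℓ`.
Ulam's approximation `P_η` preserves integrals, and its spectrum contains `1` and lies in the closed
unit disc. Hence `‖(z - P_η)⁻¹ 1‖₁ ≥ 1 / δ` in the limit `z ↓ 1 + δ`, and the number `H*`, a supremum
of a bounded set, is at least `(B₀ / (r - α₀) + 1) / δ` (`le_Hstar_ulam_div`). The first term of the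
minimum `ε₀*` is of order `r ^ (n₁ + n₂) / (B² H*)`; here `r ^ (n₁ + n₂)` is so small
(`zpow_mul_sq_lt`) that it makes up for the denominator `r - α` of `K` (`hole_bound_lt`).
-/

namespace AccimUlam

open Filter Topology

noncomputable section

/-! ### Helly's selection theorem and completeness of `BV` -/

lemma edist_add_eVariationOn_Iic_le (g : unitInterval → ℂ) {x y : unitInterval} (hxy : x ≤ y) :
    eVariationOn g (Iic x) + edist (g x) (g y) ≤ eVariationOn g (Iic y) := by
  rw [← eVariationOn.pair]
  refine (eVariationOn.add_le_union g fun a ha b hb => ?_).trans (eVariationOn.mono g ?_)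
  · rcases hb with rfl | rfl
    · exact ha
    · exact le_trans ha hxy
  · rintro z (hz | rfl | rfl)
    · exact le_trans hz hxy
    · exact hxy
    · exact mem_Iic.2 le_rfl

/-- Helly's selection theorem, with almost everywhere convergence: a uniformly bounded sequence of
uniformly bounded variation has a subsequence that converges off a null set to a function with the
same bound on the variation. The subsequence is chosen such that the functions and their variation
functions converge on a countable dense set; it then converges wherever a limit `v` of the variation
functions is continuous. -/
lemma exists_subseq_ae_tendsto (g : ℕ → unitInterval → ℂ) (M : ℝ) (C : ℝ≥0)
    (hM : ∀ n x, ‖g n x‖ ≤ M) (hC : ∀ n, eVariationOn (g n) univ ≤ C) :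
    ∃ φ : ℕ → ℕ, StrictMono φ ∧ ∃ f : unitInterval → ℂ, eVariationOn f univ ≤ C ∧
      ∀ᵐ x, Tendsto (fun n => g (φ n) x) atTop (𝓝 (f x)) := by
  set w : ℕ → unitInterval → ℝ := fun n x => (eVariationOn (g n) (Iic x)).toReal with hw
  have hfin : ∀ n (s : Set unitInterval), eVariationOn (g n) s ≤ C := fun n s =>
    (eVariationOn.mono _ (subset_univ s)).trans (hC n)
  have hfin' : ∀ n (s : Set unitInterval), eVariationOn (g n) s ≠ ⊤ := fun n s =>
    ne_top_of_le_ne_top ENNReal.coe_ne_top (hfin n s)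
  have hwC : ∀ n x, w n x ∈ Icc (0 : ℝ) C := fun n x =>
    ⟨ENNReal.toReal_nonneg, ENNReal.toReal_le_coe_of_le_coe (hfin n _)⟩
  have hgw : ∀ n (x y : unitInterval), x ≤ y → dist (g n x) (g n y) ≤ w n y - w n x := by
    intro n x y hxy
    have h := ENNReal.toReal_mono (hfin' n _) (edist_add_eVariationOn_Iic_le (g n) hxy)
    rw [ENNReal.toReal_add (hfin' n _) (edist_ne_top _ _), ← dist_edist] at h
    simp only [hw]
    linarith
  obtain ⟨D, hDc, hDd⟩ := TopologicalSpace.exists_countable_dense unitInterval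
  have : Countable D := hDc
  have hKc : IsCompact (Metric.closedBall (0 : ℂ) M ×ˢ Icc (0 : ℝ) C) :=
    (isCompact_closedBall _ _).prod isCompact_Icc
  obtain ⟨L, -, φ, hφ, hL⟩ := (isCompact_univ_pi fun _ : D => hKc).tendsto_subseq
    (x := fun n (d : D) => (g n d, w n d)) fun n d _ => ⟨by simpa using hM n d, hwC n d⟩
  have hLd := tendsto_pi_nhds.1 hL
  -- Pointwise limits along an ultrafilter extend the limits on the dense set `D`.
  have hU : (hyperfilter ℕ : Filter ℕ) ≤ atTop := Nat.hyperfilter_le_atTop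
  have ex : ∀ x, ∃ p : ℂ × ℝ,
      Tendsto (fun n => (g (φ n) x, w (φ n) x)) (hyperfilter ℕ : Filter ℕ) (𝓝 p) := by
    intro x
    obtain ⟨p, -, hp⟩ := hKc.ultrafilter_le_nhds'
      ((hyperfilter ℕ).map fun n => (g (φ n) x, w (φ n) x))
      (Filter.mem_map.2 (univ_mem' fun n => ⟨by simpa using hM (φ n) x, hwC (φ n) x⟩))
    exact ⟨p, hp⟩
  choose p hp using ex
  set f : unitInterval → ℂ := fun x => (p x).1
  set v : unitInterval → ℝ := fun x => (p x).2
  have hf : ∀ x, Tendsto (fun n => g (φ n) x) (hyperfilter ℕ : Filter ℕ) (𝓝 (f x)) :=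
    fun x => (continuous_fst.tendsto _).comp (hp x)
  have hv : ∀ x, Tendsto (fun n => w (φ n) x) (hyperfilter ℕ : Filter ℕ) (𝓝 (v x)) :=
    fun x => (continuous_snd.tendsto _).comp (hp x)
  have hfD : ∀ d : D, Tendsto (fun n => g (φ n) d) atTop (𝓝 (f d)) := fun d => by
    have h1 := (continuous_fst.tendsto _).comp (hLd d)
    rwa [tendsto_nhds_unique (hf d) (h1.mono_left hU)]
  have hvD : ∀ d : D, Tendsto (fun n => w (φ n) d) atTop (𝓝 (v d)) := fun d => by
    have h1 := (continuous_snd.tendsto _).comp (hLd d)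
    rwa [tendsto_nhds_unique (hv d) (h1.mono_left hU)]
  have hfv : ∀ x y : unitInterval, x ≤ y → dist (f x) (f y) ≤ v y - v x := fun x y hxy =>
    le_of_tendsto_of_tendsto ((hf x).dist (hf y)) ((hv y).sub (hv x))
      (Eventually.of_forall fun n => hgw (φ n) x y hxy)
  have hmono : Monotone v := fun x y hxy => by linarith [hfv x y hxy, dist_nonneg (x := f x) (y := f y)]
  refine ⟨φ, hφ, f, ?_, ?_⟩
  · by_contra! hcon
    obtain ⟨n, hn⟩ := (eVariationOn.lowerSemicontinuous_aux (fun x _ => hf x) hcon).exists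
    exact absurd (hC (φ n)) (not_le.2 hn)
  · have hnull : volume ({x | ¬ ContinuousAt v x} ∪ {0, 1}) = 0 :=
      (hmono.countable_not_continuousAt.union ((countable_singleton _).insert _)).measure_zero _
    filter_upwards [compl_mem_ae_iff.2 hnull] with x hx
    simp only [mem_compl_iff, mem_union, mem_ofPred_eq, mem_insert_iff, mem_singleton_iff,
      not_or, not_not] at hx
    obtain ⟨hcx, hx0, hx1⟩ := hx
    rw [Metric.tendsto_nhds]
    intro ε hε
    obtain ⟨a, b, hxab, hab⟩ := (mem_nhds_iff_exists_Ioo_subset' ⟨0, unitInterval.pos_iff_ne_zero.2 hx0⟩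
      ⟨1, unitInterval.lt_one_iff_ne_one.2 hx1⟩).1
        (Metric.tendsto_nhds.1 hcx.tendsto (ε / 6) (by positivity))
    obtain ⟨d, hdD, hd⟩ := hDd.exists_between hxab.1
    obtain ⟨d', hdD', hd'⟩ := hDd.exists_between hxab.2
    have h1 := hab ⟨hd.1, hd.2.trans hxab.2⟩
    have h2 := hab ⟨hxab.1.trans hd'.1, hd'.2⟩
    simp only [mem_ofPred_eq, Real.dist_eq, abs_lt] at h1 h2
    filter_upwards [Metric.tendsto_nhds.1 (hfD ⟨d, hdD⟩) (ε / 6) (by positivity),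
      Metric.tendsto_nhds.1 (hvD ⟨d, hdD⟩) (ε / 12) (by positivity),
      Metric.tendsto_nhds.1 (hvD ⟨d', hdD'⟩) (ε / 12) (by positivity)] with n e1 e2 e3
    rw [Real.dist_eq, abs_lt] at e2 e3
    have e4 := hgw (φ n) d x hd.2.le
    have e5 := hgw (φ n) x d' hd'.1.le
    have e6 := hfv d x hd.2.le
    have e7 := dist_triangle4 (g (φ n) x) (g (φ n) d) (f d) (f x)
    rw [dist_comm (g (φ n) x) (g (φ n) d)] at e7
    have e8 := dist_nonneg (x := g (φ n) x) (y := g (φ n) d')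
    linarith

/-- Sets that are bounded in `BV` are relatively sequentially compact in `L¹`. -/
lemma exists_subseq_tendsto_L1 (f : ℕ → L1) (M : ℝ) (C : ℝ≥0) (hM : ∀ n, ‖f n‖ ≤ M)
    (hC : ∀ n, V (f n) < C) :
    ∃ φ : ℕ → ℕ, StrictMono φ ∧ ∃ h : L1, V h ≤ C ∧ Tendsto (fun n => f (φ n)) atTop (𝓝 h) := by
  choose g hg hgv using fun n => exists_of_V_lt (hC n)
  have hb : ∀ n x, ‖g n x‖ ≤ M + C := by
    intro n x
    have h1 := (enorm_le_of_rep (hg n) x).trans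
      (add_le_add (ENNReal.ofReal_le_ofReal (hM n)) (hgv n).le)
    have hM0 : 0 ≤ M := (norm_nonneg _).trans (hM n)
    rw [← ofReal_norm, ← ENNReal.ofReal_coe_nnreal, ← ENNReal.ofReal_add hM0 C.coe_nonneg] at h1
    exact (ENNReal.ofReal_le_ofReal_iff (by positivity)).1 h1
  obtain ⟨φ, hφ, k, hk, hlim⟩ := exists_subseq_ae_tendsto g (M + C) C hb fun n => (hgv n).le
  have hgm : ∀ n, AEStronglyMeasurable (g n) volume := fun n =>
    (Lp.aestronglyMeasurable (f n)).congr (hg n).symm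
  have hkm : AEStronglyMeasurable k volume :=
    aestronglyMeasurable_of_tendsto_ae atTop (fun n => hgm (φ n)) hlim
  have hkb : ∀ᵐ x, ‖k x‖ ≤ M + C := by
    filter_upwards [hlim] with x hx
    exact le_of_tendsto hx.norm (Eventually.of_forall fun n => hb (φ n) x)
  have hki : Integrable k volume := Integrable.of_bound hkm _ hkb
  refine ⟨φ, hφ, hki.toL1 k, (V_le hki.coeFn_toL1.symm).trans hk, ?_⟩
  have hconv : Tendsto (fun n => ∫ x, ‖g (φ n) x - k x‖) atTop (𝓝 (∫ _ : unitInterval, (0 : ℝ))) := by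
    refine tendsto_integral_of_dominated_convergence (fun _ => (M + C) + (M + C))
      (fun n => ((hgm (φ n)).sub hkm).norm) (integrable_const _) (fun n => ?_) ?_
    · filter_upwards [hkb] with x hx
      rw [norm_norm]
      exact (norm_sub_le _ _).trans (add_le_add (hb _ _) hx)
    · filter_upwards [hlim] with x hx
      have := (hx.sub_const (k x)).norm
      simpa using this
  rw [tendsto_iff_norm_sub_tendsto_zero]
  simp only [integral_zero] at hconv
  refine hconv.congr fun n => ?_
  rw [L1.norm_eq_integral_norm]
  refine integral_congr_ae ?_
  filter_upwards [hg (φ n), Lp.coeFn_sub (f (φ n)) (hki.toL1 k), hki.coeFn_toL1] with x h1 h2 h3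
  rw [h2, Pi.sub_apply, h1, h3]

/-- The variation is lower semicontinuous with respect to convergence in `L¹`. -/
lemma V_le_of_tendsto {f : ℕ → L1} {h : L1} (hf : Tendsto f atTop (𝓝 h)) {C : ℝ≥0}
    (hC : ∀ᶠ n in atTop, V (f n) ≤ C) : V h ≤ C := by
  obtain ⟨N, hN⟩ := eventually_atTop.1 hC
  obtain ⟨M, hM⟩ := (Metric.isBounded_range_of_tendsto f hf).exists_norm_le
  refine ENNReal.le_of_forall_pos_le_add fun ε hε _ => ?_
  have hCε : (C : ℝ≥0∞) < (C + ε : ℝ≥0) := by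
    exact_mod_cast lt_add_of_pos_right C hε
  obtain ⟨φ, hφ, k, hk, hlim⟩ := exists_subseq_tendsto_L1 (fun n => f (n + N)) M (C + ε)
    (fun n => hM _ (mem_range_self _)) (fun n => (hN _ (Nat.le_add_left _ _)).trans_lt hCε)
  have : Tendsto (fun n => f (φ n + N)) atTop (𝓝 h) :=
    hf.comp ((tendsto_add_atTop_nat N).comp hφ.tendsto_atTop)
  rw [tendsto_nhds_unique this hlim]
  exact_mod_cast hk

instance : CompleteSpace BV := by
  refine Metric.complete_of_cauchySeq_tendsto fun u hu => ?_
  obtain ⟨h, hh⟩ := cauchySeq_tendsto_of_complete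
    (BV.toL1.uniformContinuous.comp_cauchySeq hu)
  have key : ∀ ε : ℝ≥0, 0 < ε → ∀ᶠ n in atTop, V (BV.toL1 (u n) - h) ≤ ε := by
    intro ε hε
    obtain ⟨N, hN⟩ := Metric.cauchySeq_iff.1 hu ε (by exact_mod_cast hε)
    filter_upwards [eventually_ge_atTop N] with n hn
    refine V_le_of_tendsto (f := fun m => BV.toL1 (u n) - BV.toL1 (u m))
      (tendsto_const_nhds.sub hh) ?_
    filter_upwards [eventually_ge_atTop N] with m hm
    have h1 := (hN n hn m hm).le
    rw [dist_eq_norm, BV.norm_eq, map_sub] at h1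
    have h2 : (V (BV.toL1 (u n) - BV.toL1 (u m))).toReal ≤ ε := by
      linarith [norm_nonneg (BV.toL1 (u n) - BV.toL1 (u m))]
    have h3 : V (BV.toL1 (u n) - BV.toL1 (u m)) ≠ ⊤ := by
      rw [← map_sub]; exact BV.V_ne_top _
    rw [← ENNReal.ofReal_toReal h3, ← ENNReal.ofReal_coe_nnreal]
    exact ENNReal.ofReal_le_ofReal h2
  have hfin : V h ≠ ⊤ := by
    obtain ⟨n, hn⟩ := (key 1 one_pos).exists
    have e : h = BV.toL1 (u n) + (-1 : ℂ) • (BV.toL1 (u n) - h) := by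
      rw [neg_one_smul]; abel
    rw [e]
    refine ne_top_of_le_ne_top (ENNReal.add_ne_top.2 ⟨BV.V_ne_top (u n), ?_⟩) (V_add_le _ _)
    rw [V_smul]
    exact ENNReal.mul_ne_top enorm_ne_top (ne_top_of_le_ne_top ENNReal.coe_ne_top hn)
  refine ⟨BV.mk h hfin, ?_⟩
  rw [tendsto_iff_norm_sub_tendsto_zero]
  have hV : Tendsto (fun n => (V (BV.toL1 (u n) - h)).toReal) atTop (𝓝 0) := by
    rw [Metric.tendsto_nhds]
    intro ε hε
    filter_upwards [key (ε / 2).toNNReal (by simpa using hε)]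
      with n hn
    have h4 := ENNReal.toReal_le_coe_of_le_coe hn
    rw [Real.dist_eq, sub_zero, abs_of_nonneg ENNReal.toReal_nonneg]
    rw [Real.coe_toNNReal _ (half_pos hε).le] at h4
    exact h4.trans_lt (half_lt_self hε)
  have hL := tendsto_iff_norm_sub_tendsto_zero.1 hh
  have := hV.add hL
  rw [add_zero] at this
  refine this.congr fun n => ?_
  rw [BV.norm_eq, map_sub, BV.toL1_mk]
  rfl

/-! ### Domination, positivity and the Lasota–Yorke inequality of the open system -/

/-- `f` is dominated by `h`: `|f| ≤ Re h` almost everywhere. In particular `Dominated f f` says that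
`f` is real and nonnegative, and `h` may be taken complex since only its real part counts. -/
def Dominated (f h : L1) : Prop := ∀ᵐ x, ‖f x‖ ≤ (h x).re

lemma setIntegral_re (h : L1) (E : Set unitInterval) :
    ∫ x in E, (h x).re = (∫ x in E, h x).re :=
  integral_re (L1.integrable h).integrableOn

/-- Domination can be tested on integrals, which the transfer operator and limits in `L¹` respect. -/
lemma dominated_iff {f h : L1} : Dominated f h ↔
    ∀ E : Set unitInterval, MeasurableSet E → ‖∫ x in E, f x‖ ≤ (∫ x in E, h x).re := by
  constructor
  · intro H E _
    rw [← setIntegral_re]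
    exact norm_integral_le_of_norm_le (L1.integrable h).re.integrableOn (ae_restrict_of_ae H)
  · intro H
    have key : ∀ c : ℂ, ∀ᵐ x, (c * f x).re ≤ ‖c‖ * (h x).re := by
      intro c
      refine ae_le_of_forall_setIntegral_le ((L1.integrable f).const_mul c).re
        ((L1.integrable h).re.const_mul _) fun E hE _ => ?_
      calc ∫ x in E, (c * f x).re = (∫ x in E, c * f x).re :=
            integral_re ((L1.integrable f).const_mul c).integrableOn
        _ ≤ ‖∫ x in E, c * f x‖ := Complex.re_le_norm _
        _ = ‖c‖ * ‖∫ x in E, f x‖ := by rw [integral_const_mul, norm_mul]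
        _ ≤ ‖c‖ * ∫ x in E, (h x).re := by
            rw [setIntegral_re]
            exact mul_le_mul_of_nonneg_left (H E hE) (norm_nonneg _)
        _ = ∫ x in E, ‖c‖ * (h x).re := (integral_const_mul _ _).symm
    filter_upwards [ae_all_iff.2 fun n => key (TopologicalSpace.denseSeq ℂ n)] with x hx
    -- By density of the test directions, the inequality holds for the direction of `conj (f x)`.
    have hall : ∀ c : ℂ, (c * f x).re ≤ ‖c‖ * (h x).re := fun c =>
      (TopologicalSpace.denseRange_denseSeq ℂ).induction_on c
        (isClosed_le (by fun_prop) (by fun_prop)) hx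
    have h1 := hall (starRingEnd ℂ (f x))
    rw [mul_comm, Complex.mul_conj, Complex.ofReal_re, Complex.normSq_eq_norm_sq, RCLike.norm_conj,
      sq] at h1
    by_cases h0 : f x = 0
    · have h2 := hall 1
      rw [h0] at h2 ⊢
      simpa using h2
    · exact le_of_mul_le_mul_left h1 (norm_pos_iff.2 h0)

namespace Dominated

lemma transfer {T : unitInterval → unitInterval}
    (hT : Measure.QuasiMeasurePreserving T volume volume) {f h : L1} (H : Dominated f h) :
    Dominated (transfer hT f) (transfer hT h) := by
  rw [dominated_iff] at H ⊢
  intro E hE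
  rw [transfer_spec hT f hE, transfer_spec hT h hE]
  exact H _ (hT.measurable hE)

lemma cutoff {s : Set unitInterval} (hs : MeasurableSet s) {f h : L1} (H : Dominated f h) :
    Dominated (cutoff hs f) (cutoff hs h) := by
  filter_upwards [H, cutoff_coe hs f, cutoff_coe hs h] with x h1 h2 h3
  rw [h2, h3]
  by_cases hx : x ∈ s <;> simp [hx, h1]

lemma openTransfer {T : unitInterval → unitInterval}
    (hT : Measure.QuasiMeasurePreserving T volume volume) {s : Set unitInterval}
    (hs : s.OrdConnected) {f h : L1} (H : Dominated f h) :
    Dominated (openTransfer hT hs f) (openTransfer hT hs h) :=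
  (H.cutoff hs.measurableSet.compl).transfer hT

lemma smul {f h : L1} (H : Dominated f h) {c : ℂ} {t : ℝ} (hc : ‖c‖ = t) :
    Dominated (c • f) ((t : ℂ) • h) := by
  filter_upwards [H, Lp.coeFn_smul c f, Lp.coeFn_smul (t : ℂ) h] with x h1 h2 h3
  rw [h2, h3, Pi.smul_apply, Pi.smul_apply, norm_smul, smul_eq_mul, Complex.re_ofReal_mul, hc]
  exact mul_le_mul_of_nonneg_left h1 (hc ▸ norm_nonneg _)

lemma zero : Dominated 0 0 := by
  exact Eventually.of_forall fun x => by simp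

lemma add {f h f' h' : L1} (H : Dominated f h) (H' : Dominated f' h') :
    Dominated (f + f') (h + h') := by
  filter_upwards [H, H', Lp.coeFn_add f f', Lp.coeFn_add h h'] with x h1 h2 h3 h4
  rw [h3, h4]
  exact (norm_add_le _ _).trans (add_le_add h1 h2)

lemma sum {ι : Type*} (s : Finset ι) {f h : ι → L1} (H : ∀ i, Dominated (f i) (h i)) :
    Dominated (∑ i ∈ s, f i) (∑ i ∈ s, h i) := by
  classical
  induction s using Finset.induction_on with
  | empty => simpa using zero
  | insert a s ha ih => rw [Finset.sum_insert ha, Finset.sum_insert ha]; exact (H a).add ih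

lemma of_tendsto {ι : Type*} {l : Filter ι} [l.NeBot] {f h : ι → L1} {f₀ h₀ : L1}
    (hf : Tendsto f l (𝓝 f₀)) (hh : Tendsto h l (𝓝 h₀)) (H : ∀ i, Dominated (f i) (h i)) :
    Dominated f₀ h₀ := by
  rw [dominated_iff]
  intro E hE
  have h1 := (((setIntegralCLM E).continuous.tendsto f₀).comp hf).norm
  have h2 := (Complex.continuous_re.tendsto _).comp
    (((setIntegralCLM E).continuous.tendsto h₀).comp hh)
  exact le_of_tendsto_of_tendsto h1 h2
    (Eventually.of_forall fun i => dominated_iff.1 (H i) E hE)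

lemma hasSum {ι : Type*} {f h : ι → L1} {f₀ h₀ : L1}
    (hf : HasSum f f₀) (hh : HasSum h h₀) (H : ∀ i, Dominated (f i) (h i)) :
    Dominated f₀ h₀ :=
  of_tendsto hf hh fun s => sum s H

lemma norm_le {f h : L1} (H : Dominated f h) : ‖f‖ ≤ (∫ x, h x).re := by
  rw [L1.norm_eq_integral_norm, ← setIntegral_univ (μ := volume) (f := (h : unitInterval → ℂ)),
    ← setIntegral_re, setIntegral_univ]
  exact integral_mono_ae (L1.integrable f).norm (L1.integrable h).re H

lemma ae_nonneg {f : L1} (H : Dominated f f) : ∀ᵐ x, 0 ≤ (f x).re ∧ (f x).im = 0 := by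
  filter_upwards [H] with x hx
  have h1 := Complex.re_le_norm (f x)
  have h2 : (f x).re = ‖f x‖ := le_antisymm h1 hx
  exact ⟨(norm_nonneg _).trans hx, by
    have := Complex.sq_norm_sub_sq_re (f x)
    rw [← h2] at this
    nlinarith⟩

lemma integral_eq {f : L1} (H : Dominated f f) : ∫ x, f x = (‖f‖ : ℂ) := by
  rw [L1.norm_eq_integral_norm, ← integral_complex_ofReal]
  refine integral_congr_ae ?_
  filter_upwards [H, H.ae_nonneg] with x hx h0
  have h2 : (f x).re = ‖f x‖ := le_antisymm (Complex.re_le_norm (f x)) hx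
  rw [← h2]
  exact Complex.ext (by simp) (by simp [h0.2])

end Dominated

lemma exists_dominated_norm (f : L1) : ∃ h : L1, Dominated f h ∧ Dominated h h ∧ ‖h‖ = ‖f‖ := by
  have hi : Integrable (fun x => ((‖f x‖ : ℝ) : ℂ)) volume := (L1.integrable f).norm.ofReal
  have hc := hi.coeFn_toL1
  refine ⟨hi.toL1 _, ?_, ?_, ?_⟩
  · filter_upwards [hc] with x hx
    rw [hx, Complex.ofReal_re]
  · filter_upwards [hc] with x hx
    rw [hx, Complex.ofReal_re, Complex.norm_real, norm_norm]
  · rw [L1.norm_eq_integral_norm, L1.norm_eq_integral_norm]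
    refine integral_congr_ae ?_
    filter_upwards [hc] with x hx
    rw [hx, Complex.norm_real, norm_norm]

lemma integral_transfer {T : unitInterval → unitInterval}
    (hT : Measure.QuasiMeasurePreserving T volume volume) (f : L1) :
    ∫ x, transfer hT f x = ∫ x, f x := by
  have h := transfer_spec hT f MeasurableSet.univ
  rwa [preimage_univ, setIntegral_univ, setIntegral_univ] at h

lemma norm_transfer_le {T : unitInterval → unitInterval}
    (hT : Measure.QuasiMeasurePreserving T volume volume) (f : L1) : ‖transfer hT f‖ ≤ ‖f‖ := by
  obtain ⟨h, hfh, hh, hn⟩ := exists_dominated_norm f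
  refine ((hfh.transfer hT).norm_le).trans ?_
  rw [integral_transfer, hh.integral_eq, hn, Complex.ofReal_re]

lemma integral_openTransfer {T : unitInterval → unitInterval}
    (hT : Measure.QuasiMeasurePreserving T volume volume) {H : Set unitInterval}
    (hH : H.OrdConnected) (f : L1) :
    ∫ x, openTransfer hT hH f x = (∫ x, f x) - ∫ x in H, f x := by
  rw [openTransfer, ContinuousLinearMap.comp_apply, integral_transfer,
    integral_congr_ae (cutoff_coe hH.measurableSet.compl f),
    integral_indicator hH.measurableSet.compl, eq_sub_iff_add_eq, add_comm]
  exact integral_add_compl hH.measurableSet (L1.integrable f)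

namespace BV

/-- The variation of an element of `BV`, as a real number. -/
def var (f : BV) : ℝ := (V (toL1 f)).toReal

lemma V_toL1_ne_top (f : BV) : V (toL1 f) ≠ ⊤ := f.V_ne_top

lemma var_nonneg (f : BV) : 0 ≤ var f := ENNReal.toReal_nonneg

lemma norm_eq_var_add (f : BV) : ‖f‖ = var f + ‖toL1 f‖ := rfl

lemma var_le_norm (f : BV) : var f ≤ ‖f‖ := by
  rw [norm_eq_var_add]; linarith [norm_nonneg (toL1 f)]

lemma norm_toL1_le (f : BV) : ‖toL1 f‖ ≤ ‖f‖ := norm_toL1Lin_le f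

lemma var_add_le (f g : BV) : var (f + g) ≤ var f + var g := by
  rw [var, var, var, ← ENNReal.toReal_add (V_toL1_ne_top f) (V_toL1_ne_top g), map_add]
  exact ENNReal.toReal_mono (ENNReal.add_ne_top.2 ⟨V_ne_top f, V_ne_top g⟩) (V_add_le _ _)

lemma var_smul (c : ℂ) (f : BV) : var (c • f) = ‖c‖ * var f := by
  rw [var, map_smul, V_smul, ENNReal.toReal_mul, toReal_enorm, var]

/-- The `BV` norm bounds the essential supremum. -/
lemma ae_norm_le (f : BV) : ∀ᵐ x, ‖toL1 f x‖ ≤ ‖f‖ := by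
  have key : ∀ n : ℕ, ∀ᵐ x, ‖toL1 f x‖ ≤ ‖f‖ + 1 / ((n : ℝ) + 1) := by
    intro n
    have hpos : (0 : ℝ) < 1 / ((n : ℝ) + 1) := Nat.one_div_pos_of_nat
    obtain ⟨g, hg, hgv⟩ := exists_of_V_lt (f := toL1 f)
      (c := ENNReal.ofReal (var f + 1 / ((n : ℝ) + 1))) (by
        rw [← ENNReal.ofReal_toReal (V_toL1_ne_top f)]
        exact (ENNReal.ofReal_lt_ofReal_iff (by have := var_nonneg f; positivity)).2
          (lt_add_of_pos_right _ hpos))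
    filter_upwards [hg] with x hx
    rw [← hx]
    have h1 := (enorm_le_of_rep hg x).trans (add_le_add_right hgv.le _)
    rw [← ofReal_norm, ← ENNReal.ofReal_add (norm_nonneg _)
      (by have := var_nonneg f; positivity)] at h1
    have h2 := (ENNReal.ofReal_le_ofReal_iff (by have := var_nonneg f; positivity)).1 h1
    rw [norm_eq_var_add]
    linarith
  filter_upwards [ae_all_iff.2 key] with x hx
  refine ge_of_tendsto' (x := atTop) ?_ hx
  simpa using (tendsto_one_div_add_atTop_nhds_zero_nat (𝕜 := ℝ)).const_add ‖f‖

lemma norm_setIntegral_le (f : BV) (H : Set unitInterval) :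
    ‖∫ x in H, toL1 f x‖ ≤ ‖f‖ * volume.real H :=
  norm_setIntegral_le_of_norm_le_const_ae' (measure_lt_top _ _)
    ((ae_norm_le f).mono fun _ h _ => h)

/-- The constant function `1`. -/
def one : BV := bvIndicator univ ordConnected_univ

lemma toL1_one_ae : ∀ᵐ x, toL1 one x = 1 := by
  have h : toL1 one = indicatorConstLp 1 MeasurableSet.univ (measure_ne_top volume _) (1 : ℂ) := rfl
  rw [h]
  exact Eventually.of_forall fun x => by simp

lemma var_one : var one = 0 := by
  have h : V (toL1 one) ≤ 0 := by
    refine (V_le (g := fun _ => 1) (toL1_one_ae.mono fun x hx => hx.symm)).trans (le_of_eq ?_)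
    exact eVariationOn.constant_on (by rintro _ ⟨x, -, rfl⟩ _ ⟨y, -, rfl⟩; rfl)
  rw [var, le_antisymm h bot_le, ENNReal.toReal_zero]

lemma integral_one : ∫ x, toL1 one x = 1 := by
  rw [integral_congr_ae toL1_one_ae]; simp

lemma dominated_one : Dominated (toL1 one) (toL1 one) := by
  filter_upwards [toL1_one_ae] with x hx
  simp [hx]

lemma norm_toL1_one : ‖toL1 one‖ = 1 := by
  have h := dominated_one.integral_eq
  rw [integral_one] at h
  exact_mod_cast h.symm

lemma norm_one : ‖one‖ = 1 := by
  rw [norm_eq_var_add, var_one, norm_toL1_one, zero_add]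

instance : Nontrivial BV :=
  ⟨⟨one, 0, fun h => by have := norm_one; rw [h, norm_zero] at this; exact zero_ne_one this⟩⟩

lemma dominated_smul_one (f : BV) : Dominated (toL1 f) (((‖f‖ : ℝ) : ℂ) • toL1 one) := by
  filter_upwards [ae_norm_le f, toL1_one_ae, Lp.coeFn_smul ((‖f‖ : ℝ) : ℂ) (toL1 one)]
    with x h1 h2 h3
  rw [h3, Pi.smul_apply, h2, smul_eq_mul, mul_one, Complex.ofReal_re]
  exact h1

end BV

lemma eVariationOn_indicator_compl_le_two {J : Set unitInterval} (hJ : J.OrdConnected) :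
    eVariationOn (Jᶜ.indicator (fun _ => (1 : ℂ))) univ ≤ 2 := by
  classical
  set a : unitInterval → ℝ := fun x => if ∃ h ∈ J, h ≤ x then 1 else 0 with ha
  set b : unitInterval → ℝ := fun x => if (∃ h ∈ J, h ≤ x) ∧ x ∉ J then 1 else 0 with hb
  have ma : Monotone a := by
    intro x y hxy
    simp only [ha]
    split_ifs with h1 h2 <;> try norm_num
    obtain ⟨h, hh, hx⟩ := h1
    exact h2 ⟨h, hh, hx.trans hxy⟩
  have mb : Monotone b := by
    intro x y hxy
    simp only [hb]
    split_ifs with h1 h2 <;> try norm_num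
    obtain ⟨⟨h, hh, hx⟩, hxJ⟩ := h1
    exact h2 ⟨⟨h, hh, hx.trans hxy⟩, fun hy => hxJ (hJ.out hh hy ⟨hx, hxy⟩)⟩
  have step : ∀ c : unitInterval → ℝ, Monotone c → (∀ x, c x = 0 ∨ c x = 1) →
      eVariationOn (fun x => (c x : ℂ)) univ ≤ 1 := by
    intro c mc hc
    have h1 : eVariationOn (Complex.ofReal ∘ c) univ ≤ ((1 : ℝ≥0) : ℝ≥0∞) * eVariationOn c univ :=
      (Complex.isometry_ofReal.lipschitz.lipschitzOnWith (s := univ)).comp_eVariationOn_le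
        (mapsTo_univ _ _)
    have h2 := (mc.monotoneOn univ).eVariationOn_eq (mem_univ (0 : unitInterval))
      (mem_univ (1 : unitInterval))
    have h3 : (univ : Set unitInterval) ∩ Icc 0 1 = univ := by
      ext x; simp [unitInterval.le_one']
    rw [h3] at h2
    rw [h2, ENNReal.coe_one, one_mul] at h1
    refine h1.trans ?_
    rw [← ENNReal.ofReal_one]
    refine ENNReal.ofReal_le_ofReal ?_
    rcases hc 0 with h | h <;> rcases hc 1 with h' | h' <;> rw [h, h'] <;> norm_num
  have va := step a ma fun x => by simp only [ha]; split_ifs <;> simp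
  have vb := step b mb fun x => by simp only [hb]; split_ifs <;> simp
  have e : Jᶜ.indicator (fun _ => (1 : ℂ))
      = ((fun _ => (1 : ℂ)) + (-1 : ℂ) • (fun x => (a x : ℂ))) + (fun x => (b x : ℂ)) := by
    funext x
    simp only [ha, hb, Pi.add_apply, Pi.smul_apply]
    by_cases hx : x ∈ J
    · have : ∃ h ∈ J, h ≤ x := ⟨x, hx, le_rfl⟩
      simp [hx, this]
    · by_cases h : ∃ h ∈ J, h ≤ x <;> simp [hx, h]
  have h1 : eVariationOn (fun _ : unitInterval => (1 : ℂ)) univ = 0 :=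
    eVariationOn.constant_on (by rintro _ ⟨x, -, rfl⟩ _ ⟨y, -, rfl⟩; rfl)
  rw [e]
  calc _ ≤ eVariationOn (fun _ : unitInterval => (1 : ℂ)) univ
        + eVariationOn ((-1 : ℂ) • (fun x => (a x : ℂ))) univ
        + eVariationOn (fun x => (b x : ℂ)) univ :=
        (eVariationOn_add_le _ _).trans (add_le_add_left (eVariationOn_add_le _ _) _)
    _ ≤ 0 + ‖(-1 : ℂ)‖ₑ * 1 + 1 := by
        gcongr
        · exact h1.le
        · exact (eVariationOn_const_smul_le _ _).trans (by gcongr)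
    _ = 2 := by rw [enorm_neg, enorm_one]; norm_num

/-- The Lasota–Yorke inequality of the map with hole: cutting out an interval at most triples the
variation and adds `2 ‖f‖₁`. -/
lemma var_openTransferBV_le {T : unitInterval → unitInterval}
    (hT : Measure.QuasiMeasurePreserving T volume volume) {α₀ B₀ : ℝ} (hα₀ : 0 ≤ α₀)
    (hB₀ : 0 ≤ B₀) (hA : LasotaYorke hT α₀ B₀) {H : Set unitInterval} (hH : H.OrdConnected)
    (f : BV) :
    (openTransferBV hT hA hH f).var ≤ 3 * α₀ * f.var + (2 * α₀ + B₀) * ‖BV.toL1 f‖ := by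
  have hs := hH.measurableSet.compl
  have hvar := boundedVariationOn_indicator_compl hH
  set c := (eVariationOn (Hᶜ.indicator (fun _ => (1 : ℂ))) univ).toReal with hc
  have hc0 : 0 ≤ c := ENNReal.toReal_nonneg
  have hc2 : c ≤ 2 := ENNReal.toReal_le_of_le_ofReal (by norm_num)
    (by simpa using eVariationOn_indicator_compl_le_two hH)
  set g : BV := BV.restrictOp (cutoff hs) _ _ (V_cutoff_le hs hvar) f with hg
  have h1 : g.var ≤ (1 + c) * f.var + c * ‖BV.toL1 f‖ := by
    have h := V_cutoff_le hs hvar (BV.toL1 f) (BV.V_toL1_ne_top f)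
    rw [← hc] at h
    refine (ENNReal.toReal_mono (by finiteness [BV.V_toL1_ne_top f]) h).trans (le_of_eq ?_)
    rw [ENNReal.toReal_add (by finiteness [BV.V_toL1_ne_top f]) (by finiteness),
      ENNReal.toReal_mul, ENNReal.toReal_mul, ENNReal.toReal_ofReal (by positivity),
      ENNReal.toReal_ofReal hc0, ENNReal.toReal_ofReal (norm_nonneg _)]
    rfl
  have h2 : (openTransferBV hT hA hH f).var ≤ α₀ * g.var + B₀ * ‖BV.toL1 g‖ := by
    have h := hA (BV.toL1 g) (BV.V_toL1_ne_top g)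
    refine (ENNReal.toReal_mono (by finiteness [BV.V_toL1_ne_top g]) h).trans (le_of_eq ?_)
    rw [ENNReal.toReal_add (by finiteness [BV.V_toL1_ne_top g]) (by finiteness),
      ENNReal.toReal_mul, ENNReal.toReal_mul, ENNReal.toReal_ofReal hα₀,
      ENNReal.toReal_ofReal hB₀, ENNReal.toReal_ofReal (norm_nonneg _)]
    rfl
  have h3 : ‖BV.toL1 g‖ ≤ ‖BV.toL1 f‖ := by
    refine Lp.norm_le_norm_of_ae_le ?_
    filter_upwards [cutoff_coe hs (BV.toL1 f)] with x hx
    have : BV.toL1 g x = cutoff hs (BV.toL1 f) x := rfl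
    rw [this, hx]
    exact norm_indicator_le_norm_self _ _
  have h4 := f.var_nonneg
  have h5 := norm_nonneg (BV.toL1 f)
  have h6 : g.var ≤ 3 * f.var + 2 * ‖BV.toL1 f‖ := by nlinarith
  nlinarith [mul_le_mul_of_nonneg_left h6 hα₀, mul_le_mul_of_nonneg_left h3 hB₀]

/-! ### Spectral radius and positive eigenvectors -/

section BanachAlgebra

variable {𝔸 : Type*} [NormedRing 𝔸] [NormedAlgebra ℂ 𝔸]

lemma smul_resolvent {x : 𝔸} {z : ℂ} (hz : z ∈ resolventSet ℂ x) :
    z • resolvent x z = 1 + x * resolvent x z := by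
  have h : (algebraMap ℂ 𝔸 z - x) * resolvent x z = 1 := Ring.mul_inverse_cancel _ hz
  rw [sub_mul, Algebra.algebraMap_eq_smul_one, smul_mul_assoc, one_mul, sub_eq_iff_eq_add] at h
  exact h

variable [CompleteSpace 𝔸]

lemma summable_norm_pow_mul {x : 𝔸} {t : ℝ≥0} (ht : spectralRadius ℂ x < t) :
    Summable fun n : ℕ => (t : ℝ)⁻¹ ^ (n + 1) * ‖x ^ n‖ := by
  obtain ⟨s, hs, hst⟩ := ENNReal.lt_iff_exists_nnreal_btwn.1 ht
  have hst' : s < t := by exact_mod_cast hst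
  have ht0 : (0 : ℝ) < t := (NNReal.coe_nonneg s).trans_lt (by exact_mod_cast hst')
  have hev := (spectrum.pow_nnnorm_pow_one_div_tendsto_nhds_spectralRadius x).eventually_lt_const hs
  have hgeo : Summable fun n : ℕ => (t : ℝ)⁻¹ * ((s : ℝ) / t) ^ n :=
    (summable_geometric_of_lt_one (by positivity)
      ((div_lt_one ht0).2 (by exact_mod_cast hst'))).mul_left _
  refine Summable.of_norm_bounded_eventually_nat hgeo ?_
  filter_upwards [hev, eventually_gt_atTop 0] with n hn hn0
  have h1 : (‖x ^ n‖₊ : ℝ≥0∞) ≤ (s : ℝ≥0∞) ^ n := by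
    have := ENNReal.rpow_le_rpow hn.le (Nat.cast_nonneg n : (0 : ℝ) ≤ n)
    rwa [← ENNReal.rpow_mul, one_div, inv_mul_cancel₀ (by positivity), ENNReal.rpow_one,
      ENNReal.rpow_natCast] at this
  have h2 : ‖x ^ n‖ ≤ (s : ℝ) ^ n := by exact_mod_cast h1
  rw [norm_mul, norm_norm, Real.norm_of_nonneg (by positivity), pow_succ', div_pow, mul_assoc,
    inv_pow, div_eq_inv_mul]
  gcongr

/-- The Neumann series represents the resolvent outside of the disc given by the spectral radius. -/
lemma hasSum_resolvent {x : 𝔸} {z : ℂ} (hz : spectralRadius ℂ x < ‖z‖₊) :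
    HasSum (fun n : ℕ => z⁻¹ ^ (n + 1) • x ^ n) (resolvent x z) := by
  have hz0 : z ≠ 0 := by
    rintro rfl
    simp at hz
  have hsum : Summable fun n : ℕ => z⁻¹ ^ (n + 1) • x ^ n := by
    refine Summable.of_norm ((summable_norm_pow_mul hz).congr fun n => ?_)
    rw [norm_smul, norm_pow z⁻¹, norm_inv, coe_nnnorm]
  obtain ⟨S, hS⟩ := hsum
  have h1 : HasSum (fun n : ℕ => z⁻¹ ^ (n + 1) • x ^ (n + 1)) (x * S) := by
    refine (hS.mul_left x).congr_fun fun n => ?_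
    rw [mul_smul_comm, pow_succ' x]
  have h2 : HasSum (fun n : ℕ => z⁻¹ ^ n • x ^ n) (z • S) := by
    refine (hS.const_smul z).congr_fun fun n => ?_
    rw [smul_smul, pow_succ', mul_inv_cancel_left₀ hz0]
  have h3 : z • S = 1 + x * S := by
    have := (hasSum_nat_add_iff' (f := fun n : ℕ => z⁻¹ ^ n • x ^ n) 1).2 h2
    rw [Finset.sum_range_one, pow_zero, pow_zero, one_smul] at this
    rw [h1.unique this, add_sub_cancel]
  have h4 : (algebraMap ℂ 𝔸 z - x) * S = 1 := by
    rw [sub_mul, Algebra.algebraMap_eq_smul_one, smul_mul_assoc, one_mul, h3, add_sub_cancel_right]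
  have h5 : resolvent x z * (algebraMap ℂ 𝔸 z - x) = 1 :=
    Ring.inverse_mul_cancel _ (spectrum.mem_resolventSet_of_spectralRadius_lt hz)
  rw [left_inv_eq_right_inv h5 h4]
  exact hS

/-- The resolvent blows up near the spectrum. -/
lemma one_le_norm_sub_mul_norm_resolvent {x : 𝔸} {z w : ℂ} (hz : z ∈ resolventSet ℂ x)
    (hw : w ∈ spectrum ℂ x) : 1 ≤ ‖w - z‖ * ‖resolvent x z‖ := by
  by_contra! h
  refine hw ?_
  have h1 : ‖-((w - z) • resolvent x z)‖ < 1 := by rwa [norm_neg, norm_smul]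
  have h2 : algebraMap ℂ 𝔸 w - x
      = (algebraMap ℂ 𝔸 z - x) * (1 - -((w - z) • resolvent x z)) := by
    have h : (algebraMap ℂ 𝔸 z - x) * resolvent x z = 1 := Ring.mul_inverse_cancel _ hz
    rw [sub_neg_eq_add, mul_add, mul_one, mul_smul_comm, h, ← Algebra.algebraMap_eq_smul_one,
      map_sub]
    abel
  rw [resolventSet, mem_ofPred_eq, h2]
  exact IsUnit.mul hz (isUnit_one_sub_of_norm_lt_one h1)

end BanachAlgebra

/-- The operator `A` on `BV` is the restriction of an operator `A₁` on `L¹` that respects domination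
(so `A₁` is positive), and it satisfies the Lasota–Yorke inequality `V (A f) ≤ a V f + c ‖f‖₁`. -/
structure PositiveLY (A : BV →L[ℂ] BV) (A₁ : L1 →L[ℂ] L1) (a c : ℝ) : Prop where
  toL1_apply : ∀ f, BV.toL1 (A f) = A₁ (BV.toL1 f)
  dominated : ∀ {f h : L1}, Dominated f h → Dominated (A₁ f) (A₁ h)
  nonneg : 0 ≤ c
  var_le : ∀ f, (A f).var ≤ a * f.var + c * ‖BV.toL1 f‖

namespace PositiveLY

variable {A : BV →L[ℂ] BV} {A₁ : L1 →L[ℂ] L1} {a c : ℝ}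

lemma toL1_pow (h : PositiveLY A A₁ a c) (n : ℕ) (f : BV) :
    BV.toL1 ((A ^ n) f) = (A₁ ^ n) (BV.toL1 f) := by
  induction n generalizing f with
  | zero => simp
  | succ n ih => rw [pow_succ, pow_succ, mul_apply_eq_comp, ih, h.toL1_apply]; rfl

lemma dominated_pow (h : PositiveLY A A₁ a c) (n : ℕ) {f g : L1} (H : Dominated f g) :
    Dominated ((A₁ ^ n) f) ((A₁ ^ n) g) := by
  induction n generalizing f g with
  | zero => simpa
  | succ n ih => rw [pow_succ]; exact ih (h.dominated H)

lemma hasSum_resolvent_apply {z : ℂ} (h : PositiveLY A A₁ a c)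
    (hz : spectralRadius ℂ A < ‖z‖₊) (f : BV) :
    HasSum (fun n : ℕ => z⁻¹ ^ (n + 1) • (A₁ ^ n) (BV.toL1 f)) (BV.toL1 (resolvent A z f)) := by
  have h1 := (hasSum_resolvent hz).mapL (BV.toL1.comp ((ContinuousLinearMap.apply ℂ BV f)))
  refine h1.congr_fun fun n => ?_
  rw [ContinuousLinearMap.comp_apply, ContinuousLinearMap.apply_apply,
    smul_apply, map_smul, h.toL1_pow]

lemma dominated_resolvent {z : ℂ} {t : ℝ} (h : PositiveLY A A₁ a c) (ht : ‖z‖ = t)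
    (hz : spectralRadius ℂ A < ‖z‖₊) {f g : BV} (H : Dominated (BV.toL1 f) (BV.toL1 g)) :
    Dominated (BV.toL1 (resolvent A z f)) (BV.toL1 (resolvent A (t : ℂ) g)) := by
  have ht0 : 0 ≤ t := ht ▸ norm_nonneg z
  have hz' : spectralRadius ℂ A < ‖(t : ℂ)‖₊ := by
    rwa [show ‖(t : ℂ)‖₊ = ‖z‖₊ from NNReal.eq (by simp [ht, abs_of_nonneg ht0])]
  refine Dominated.hasSum (h.hasSum_resolvent_apply hz f) (h.hasSum_resolvent_apply hz' g)
    fun n => ?_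
  have := (h.dominated_pow n H).smul (c := z⁻¹ ^ (n + 1)) (t := t⁻¹ ^ (n + 1))
    (by rw [norm_pow, norm_inv, ht])
  rwa [Complex.ofReal_pow, Complex.ofReal_inv] at this

lemma smul_resolvent_apply {z : ℂ} (hz : spectralRadius ℂ A < ‖z‖₊) (f : BV) :
    z • resolvent A z f = f + A (resolvent A z f) := by
  have := congrArg (fun B : BV →L[ℂ] BV => B f)
    (smul_resolvent (spectrum.mem_resolventSet_of_spectralRadius_lt hz))
  simpa using this

lemma var_resolvent_le {z : ℂ} (h : PositiveLY A A₁ a c) (hz : spectralRadius ℂ A < ‖z‖₊) (f : BV) :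
    (‖z‖ - a) * (resolvent A z f).var ≤ f.var + c * ‖BV.toL1 (resolvent A z f)‖ := by
  have h1 := BV.var_smul z (resolvent A z f)
  rw [smul_resolvent_apply hz] at h1
  have h2 := BV.var_add_le f (A (resolvent A z f))
  have h3 := h.var_le (resolvent A z f)
  linarith

/-- The mass of `(t - A)⁻¹ 1` is unbounded as `t` decreases to the spectral radius `ρ`. Otherwise, by
positivity, the weak norm of `(z - A)⁻¹` is bounded for `|z|` slightly above `ρ`; by the Lasota–Yorke
inequality so is its norm on `BV`, which is impossible near a spectral value of modulus `ρ`. -/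
lemma exists_norm_resolvent_one_gt (h : PositiveLY A A₁ a c) {ρ : ℝ} (hρ : 0 < ρ)
    (hA : spectralRadius ℂ A = ENNReal.ofReal ρ) (ha : a < ρ) {η : ℝ} (hη : 0 < η) (M : ℝ) :
    ∃ t, ρ < t ∧ t < ρ + η ∧ M < ‖BV.toL1 (resolvent A (t : ℂ) BV.one)‖ := by
  by_contra! hcon
  have hM0 : 0 ≤ M := (norm_nonneg _).trans (hcon (ρ + η / 2) (by linarith) (by linarith))
  obtain ⟨w, hw, hwρ⟩ := spectrum.exists_nnnorm_eq_spectralRadius A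
  have hwn : ‖w‖ = ρ := by
    rw [hA, ← ENNReal.ofReal_coe_nnreal, ENNReal.ofReal_eq_ofReal_iff (by positivity) hρ.le] at hwρ
    exact hwρ
  have hlt : ∀ z : ℂ, ρ < ‖z‖ → spectralRadius ℂ A < ‖z‖₊ := fun z hz => by
    rw [hA, ← ENNReal.ofReal_coe_nnreal]
    exact (ENNReal.ofReal_lt_ofReal_iff (hρ.trans hz)).2 hz
  set K := M + (1 + c * M) / (ρ - a) with hK
  have hK0 : 0 ≤ K := by have := h.nonneg; have : 0 < ρ - a := by linarith
                         positivity
  have bound : ∀ z : ℂ, ρ < ‖z‖ → ‖z‖ < ρ + η → ‖resolvent A z‖ ≤ K := by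
    intro z hz hz'
    refine ContinuousLinearMap.opNorm_le_bound _ hK0 fun f => ?_
    have h1 : ‖BV.toL1 (resolvent A z f)‖ ≤ M * ‖f‖ := by
      have hd := h.dominated_resolvent (t := ‖z‖) rfl (hlt z hz) (f := f)
        (g := ((‖f‖ : ℝ) : ℂ) • BV.one) (by rw [map_smul]; exact BV.dominated_smul_one f)
      refine hd.norm_le.trans ((Complex.re_le_norm _).trans ?_)
      have h2 : ‖∫ x, BV.toL1 (resolvent A (‖z‖ : ℂ) (((‖f‖ : ℝ) : ℂ) • BV.one)) x‖
          ≤ ‖BV.toL1 (resolvent A (‖z‖ : ℂ) (((‖f‖ : ℝ) : ℂ) • BV.one))‖ := by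
        rw [L1.norm_eq_integral_norm]
        exact norm_integral_le_integral_norm _
      refine h2.trans ?_
      rw [map_smul, map_smul, norm_smul, Complex.norm_real, norm_norm, mul_comm]
      exact mul_le_mul_of_nonneg_right (hcon _ hz hz') (norm_nonneg _)
    have h2 := h.var_resolvent_le (hlt z hz) f
    have h3 : (resolvent A z f).var ≤ (1 + c * M) / (ρ - a) * ‖f‖ := by
      rw [div_mul_eq_mul_div, le_div_iff₀ (by linarith)]
      have h4 : (ρ - a) * (resolvent A z f).var ≤ (‖z‖ - a) * (resolvent A z f).var :=
        mul_le_mul_of_nonneg_right (by linarith) (BV.var_nonneg _)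
      have h5 := mul_le_mul_of_nonneg_left h1 h.nonneg
      have h6 := f.var_le_norm
      linarith
    rw [BV.norm_eq_var_add, hK, add_mul]
    linarith
  -- Approach the spectral value `w` radially from outside.
  set τ := min (η / 2) (1 / (2 * (K + 1))) with hτ
  have hτ0 : 0 < τ := by positivity
  set z : ℂ := ((1 + τ / ρ : ℝ) : ℂ) * w with hz
  have hzn : ‖z‖ = ρ + τ := by
    rw [hz, norm_mul, Complex.norm_real, hwn, Real.norm_of_nonneg (by positivity)]
    field_simp
  have hwz : ‖w - z‖ = τ := by
    have : w - z = ((-(τ / ρ) : ℝ) : ℂ) * w := by rw [hz]; push_cast; ring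
    rw [this, norm_mul, Complex.norm_real, hwn, norm_neg, Real.norm_of_nonneg (by positivity)]
    field_simp
  have hb := bound z (by rw [hzn]; linarith) (by
    rw [hzn]; have := min_le_left (η / 2) (1 / (2 * (K + 1))); linarith)
  have h1 := one_le_norm_sub_mul_norm_resolvent
    (spectrum.mem_resolventSet_of_spectralRadius_lt (hlt z (by rw [hzn]; linarith))) hw
  rw [hwz] at h1
  have h2 : τ * ‖resolvent A z‖ ≤ 1 / (2 * (K + 1)) * K :=
    mul_le_mul (min_le_right _ _) hb (norm_nonneg _) (by positivity)
  have h3 : 1 / (2 * (K + 1)) * K < 1 := by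
    rw [one_div_mul_eq_div, div_lt_one (by positivity)]; linarith
  linarith

/-- If the spectral radius exceeds the contraction rate of the Lasota–Yorke inequality, it is an
eigenvalue with a positive eigenvector. -/
theorem exists_eigenvector (h : PositiveLY A A₁ a c) {ρ : ℝ} (hρ : 0 < ρ)
    (hA : spectralRadius ℂ A = ENNReal.ofReal ρ) (ha : a < ρ) :
    ∃ f : BV, Dominated (BV.toL1 f) (BV.toL1 f) ∧ ‖BV.toL1 f‖ = 1 ∧ A f = (ρ : ℂ) • f := by
  choose t ht ht' hM using fun n : ℕ => h.exists_norm_resolvent_one_gt hρ hA ha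
    (η := 1 / ((n : ℝ) + 1)) Nat.one_div_pos_of_nat ((n : ℝ) + 1)
  set F : ℕ → BV := fun n => resolvent A (t n : ℂ) BV.one with hF
  set s : ℕ → ℝ := fun n => ‖BV.toL1 (F n)‖ with hs
  have hs0 : ∀ n, 0 < s n := fun n => lt_trans (by positivity) (hM n)
  have htn : ∀ n, ‖(t n : ℂ)‖ = t n := fun n => by
    rw [Complex.norm_real, Real.norm_of_nonneg (hρ.trans (ht n)).le]
  have hlt : ∀ n, spectralRadius ℂ A < ‖(t n : ℂ)‖₊ := fun n => by
    rw [hA, ← ENNReal.ofReal_coe_nnreal, coe_nnnorm, htn]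
    exact (ENNReal.ofReal_lt_ofReal_iff (hρ.trans (ht n))).2 (ht n)
  have hdom : ∀ n, Dominated (BV.toL1 (F n)) (BV.toL1 (F n)) := fun n =>
    h.dominated_resolvent (htn n) (hlt n) BV.dominated_one
  have hra : 0 < ρ - a := by linarith
  have hvar : ∀ n, (F n).var ≤ c / (ρ - a) * s n := fun n => by
    have h1 := h.var_resolvent_le (hlt n) BV.one
    rw [BV.var_one, zero_add, htn] at h1
    rw [div_mul_eq_mul_div, le_div_iff₀ hra]
    have h2 : (ρ - a) * (F n).var ≤ (t n - a) * (F n).var :=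
      mul_le_mul_of_nonneg_right (by linarith [ht n]) (BV.var_nonneg _)
    rw [mul_comm]
    exact h2.trans h1
  set g : ℕ → BV := fun n => (((s n)⁻¹ : ℝ) : ℂ) • F n with hg
  have hnn : ∀ n, ‖(((s n)⁻¹ : ℝ) : ℂ)‖ = (s n)⁻¹ := fun n => by
    rw [Complex.norm_real, Real.norm_of_nonneg (inv_nonneg.2 (hs0 n).le)]
  have hg1 : ∀ n, ‖BV.toL1 (g n)‖ = 1 := fun n => by
    rw [hg, map_smul, norm_smul, hnn]
    exact inv_mul_cancel₀ (hs0 n).ne'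
  have hgd : ∀ n, Dominated (BV.toL1 (g n)) (BV.toL1 (g n)) := fun n => by
    have := (hdom n).smul (hnn n)
    rwa [← map_smul] at this
  have hgv : ∀ n, (g n).var ≤ c / (ρ - a) := fun n => by
    rw [hg, BV.var_smul, hnn, inv_mul_le_iff₀ (hs0 n), mul_comm]
    exact hvar n
  have hc := h.nonneg
  have hgV : ∀ n, V (BV.toL1 (g n)) < ((c / (ρ - a) + 1).toNNReal : ℝ≥0) := fun n => by
    rw [← ENNReal.ofReal_toReal (BV.V_toL1_ne_top (g n))]
    exact (ENNReal.ofReal_lt_ofReal_iff (by positivity)).2 ((hgv n).trans_lt (by linarith))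
  obtain ⟨φ, hφ, k, hk, hlim⟩ := exists_subseq_tendsto_L1 _ 1 _ (fun n => (hg1 n).le) hgV
  refine ⟨BV.mk k (ne_top_of_le_ne_top ENNReal.coe_ne_top hk), ?_, ?_, BV.toL1_injective ?_⟩
  · rw [BV.toL1_mk]
    exact Dominated.of_tendsto hlim hlim fun n => hgd (φ n)
  · rw [BV.toL1_mk]
    refine tendsto_nhds_unique hlim.norm ?_
    simp only [hg1, tendsto_const_nhds]
  · rw [h.toL1_apply, map_smul, BV.toL1_mk]
    have htlim : Tendsto t atTop (𝓝 ρ) := by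
      refine tendsto_of_tendsto_of_tendsto_of_le_of_le tendsto_const_nhds ?_
        (fun n => (ht n).le) (fun n => (ht' n).le)
      simpa using (tendsto_one_div_add_atTop_nhds_zero_nat (𝕜 := ℝ)).const_add ρ
    have hslim : Tendsto (fun n => (s n)⁻¹) atTop (𝓝 0) := by
      refine squeeze_zero (fun n => inv_nonneg.2 (hs0 n).le) (fun n => ?_)
        (tendsto_one_div_add_atTop_nhds_zero_nat (𝕜 := ℝ))
      rw [one_div]
      exact inv_anti₀ (by positivity) (hM n).le
    have hAg : ∀ n, A₁ (BV.toL1 (g n))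
        = (t n : ℂ) • BV.toL1 (g n) - (((s n)⁻¹ : ℝ) : ℂ) • BV.toL1 BV.one := fun n => by
      have h1 := smul_resolvent_apply (hlt n) BV.one
      have h2 : A (F n) = (t n : ℂ) • F n - BV.one := by
        rw [h1]; abel
      rw [← h.toL1_apply, ← map_smul, ← map_smul, ← map_sub, hg, map_smul, h2, smul_sub,
        smul_comm]
    have l1 := (A₁.continuous.tendsto k).comp hlim
    have l2 : Tendsto (fun n => (t (φ n) : ℂ) • BV.toL1 (g (φ n))
        - (((s (φ n))⁻¹ : ℝ) : ℂ) • BV.toL1 BV.one) atTop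
        (𝓝 ((ρ : ℂ) • k - ((0 : ℝ) : ℂ) • BV.toL1 BV.one)) :=
      (((Complex.continuous_ofReal.tendsto _).comp (htlim.comp hφ.tendsto_atTop)).smul hlim).sub
        (((Complex.continuous_ofReal.tendsto _).comp (hslim.comp hφ.tendsto_atTop)).smul_const _)
    rw [Complex.ofReal_zero, zero_smul, sub_zero] at l2
    exact tendsto_nhds_unique l1 (l2.congr fun n => (hAg (φ n)).symm)

end PositiveLY

/-! ### The spectral radius of an open system -/

section OpenSystem

variable {T : unitInterval → unitInterval} (hT : Measure.QuasiMeasurePreserving T volume volume)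
  {α₀ B₀ : ℝ} (hA : LasotaYorke hT α₀ B₀) {H : Set unitInterval} (hH : H.OrdConnected)

lemma positiveLY_openTransfer (hα₀ : 0 ≤ α₀) (hB₀ : 0 ≤ B₀) :
    PositiveLY (openTransferBV hT hA hH) (openTransfer hT hH) (3 * α₀) (2 * α₀ + B₀) where
  toL1_apply := toL1_openTransferBV hT hA hH
  dominated H := H.openTransfer hT hH
  nonneg := by positivity
  var_le := var_openTransferBV_le hT hα₀ hB₀ hA hH

/-- On positive functions, the mass lost in one step is at most `λ(H) ‖f‖`. -/
lemma norm_toL1_openTransferBV_ge {f : BV} (hf : Dominated (BV.toL1 f) (BV.toL1 f)) :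
    ‖BV.toL1 f‖ - volume.real H * ‖f‖ ≤ ‖BV.toL1 (openTransferBV hT hA hH f)‖ := by
  have h1 := integral_openTransfer hT hH (BV.toL1 f)
  have hd := hf.openTransfer hT hH
  rw [hd.integral_eq, hf.integral_eq] at h1
  have h2 := BV.norm_setIntegral_le f H
  have h3 := congrArg Complex.re h1
  rw [Complex.sub_re, Complex.ofReal_re, Complex.ofReal_re] at h3
  have h4 := Complex.re_le_norm (∫ x in H, BV.toL1 f x)
  rw [toL1_openTransferBV]
  linarith

/-- With `K = (2 α₀ + B₀) / (r - 3 α₀)`, the iterates of `1` stay in the cone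
`{f ≥ 0, V f ≤ K ‖f‖₁}`, and each step keeps at least the fraction `q ≥ r` of the mass. -/
lemma cone_pow (hα₀ : 0 ≤ α₀) (hB₀ : 0 ≤ B₀) {r q : ℝ} (hr : 3 * α₀ < r)
    (hq : q = 1 - (1 + (2 * α₀ + B₀) / (r - 3 * α₀)) * volume.real H) (hrq : r ≤ q) (n : ℕ) :
    Dominated (BV.toL1 ((openTransferBV hT hA hH ^ n) BV.one))
        (BV.toL1 ((openTransferBV hT hA hH ^ n) BV.one)) ∧
      ((openTransferBV hT hA hH ^ n) BV.one).var
        ≤ (2 * α₀ + B₀) / (r - 3 * α₀) * ‖BV.toL1 ((openTransferBV hT hA hH ^ n) BV.one)‖ ∧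
      q ^ n ≤ ‖BV.toL1 ((openTransferBV hT hA hH ^ n) BV.one)‖ := by
  have hpos := positiveLY_openTransfer hT hA hH hα₀ hB₀
  set A := openTransferBV hT hA hH
  set K := (2 * α₀ + B₀) / (r - 3 * α₀) with hK
  have hK0 : 0 ≤ K := div_nonneg (by positivity) (by linarith)
  have hKr : 3 * α₀ * K + (2 * α₀ + B₀) = K * r := by
    rw [hK]; field_simp [(by linarith : r - 3 * α₀ ≠ 0)]; ring
  have hq0 : 0 ≤ q := by linarith
  induction n with
  | zero => simpa [BV.var_one, BV.norm_toL1_one, hK0] using BV.dominated_one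
  | succ n ih =>
    obtain ⟨h1, h2, h3⟩ := ih
    rw [pow_succ', mul_apply_eq_comp]
    set g := (A ^ n) BV.one
    have h4 : q * ‖BV.toL1 g‖ ≤ ‖BV.toL1 (A g)‖ := by
      refine le_trans ?_ (norm_toL1_openTransferBV_ge hT hA hH h1)
      rw [BV.norm_eq_var_add, hq]
      have := mul_le_mul_of_nonneg_left h2 (measureReal_nonneg (μ := volume) (s := H))
      linarith
    refine ⟨?_, ?_, ?_⟩
    · rw [hpos.toL1_apply]; exact hpos.dominated h1
    · have h5 := hpos.var_le g
      have h6 : 3 * α₀ * g.var ≤ 3 * α₀ * (K * ‖BV.toL1 g‖) :=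
        mul_le_mul_of_nonneg_left h2 (by positivity)
      have h7 : K * (r * ‖BV.toL1 g‖) ≤ K * ‖BV.toL1 (A g)‖ :=
        mul_le_mul_of_nonneg_left
          ((mul_le_mul_of_nonneg_right hrq (norm_nonneg _)).trans h4) hK0
      have h8 : 3 * α₀ * (K * ‖BV.toL1 g‖) + (2 * α₀ + B₀) * ‖BV.toL1 g‖
          = K * (r * ‖BV.toL1 g‖) := by rw [← mul_assoc, ← add_mul, hKr, mul_assoc]
      linarith
    · rw [pow_succ']
      exact (mul_le_mul_of_nonneg_left h3 hq0).trans h4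

lemma le_spectralRadius_openTransferBV (hα₀ : 0 ≤ α₀) (hB₀ : 0 ≤ B₀) {r q : ℝ}
    (hr : 3 * α₀ < r) (hq : q = 1 - (1 + (2 * α₀ + B₀) / (r - 3 * α₀)) * volume.real H)
    (hrq : r ≤ q) : ENNReal.ofReal q ≤ spectralRadius ℂ (openTransferBV hT hA hH) := by
  refine ge_of_tendsto
    (spectrum.pow_norm_pow_one_div_tendsto_nhds_spectralRadius (openTransferBV hT hA hH)) ?_
  filter_upwards [eventually_gt_atTop 0] with n hn
  have hq0 : 0 ≤ q := by linarith
  have h1 := (cone_pow hT hA hH hα₀ hB₀ hr hq hrq n).2.2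
  have h2 := (openTransferBV hT hA hH ^ n).le_opNorm BV.one
  rw [BV.norm_one, mul_one] at h2
  have h3 := h1.trans ((BV.norm_toL1_le _).trans h2)
  refine ENNReal.ofReal_le_ofReal ?_
  calc q = (q ^ n) ^ (1 / (n : ℝ)) := by
        rw [one_div, Real.pow_rpow_inv_natCast hq0 hn.ne']
    _ ≤ _ := Real.rpow_le_rpow (by positivity) h3 (by positivity)

/-- The conclusions for every hole that is small in terms of the Lasota–Yorke constants and of a
prescribed lower bound `r` for the spectral radius. -/
theorem exists_accim_of_small_hole (hα₀ : 0 ≤ α₀) (hB₀ : 0 ≤ B₀) {r : ℝ} (hr : 3 * α₀ < r)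
    (hsmall : (1 + (2 * α₀ + B₀) / (r - 3 * α₀)) * volume.real H ≤ 1 - r) :
    ∃ (e : ℝ) (f : BV), 0 < e ∧ e ≤ 1 ∧
      Module.End.HasEigenvector (openTransferBV hT hA hH : BV →ₗ[ℂ] BV) (e : ℂ) f ∧
      spectralRadius ℂ (openTransferBV hT hA hH) = ENNReal.ofReal e ∧
      IsDensity (BV.toL1 f) ∧
      (IsAccimDensity hT hH e (BV.toL1 f) ∨
        (e = 1 ∧ transfer hT (BV.toL1 f) = BV.toL1 f ∧ ∀ᵐ x, x ∈ H → BV.toL1 f x = 0)) ∧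
      1 - e ≤ (1 + (2 * α₀ + B₀) / (r - 3 * α₀)) * volume.real H := by
  have hpos := positiveLY_openTransfer hT hA hH hα₀ hB₀
  have hge := le_spectralRadius_openTransferBV hT hA hH hα₀ hB₀ hr rfl (by linarith)
  have hfin : spectralRadius ℂ (openTransferBV hT hA hH) ≠ ⊤ :=
    ne_top_of_le_ne_top ENNReal.coe_ne_top (spectrum.spectralRadius_le_nnnorm _)
  set e := (spectralRadius ℂ (openTransferBV hT hA hH)).toReal with he
  have hsr : spectralRadius ℂ (openTransferBV hT hA hH) = ENNReal.ofReal e :=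
    (ENNReal.ofReal_toReal hfin).symm
  rw [hsr, ENNReal.ofReal_le_ofReal_iff ENNReal.toReal_nonneg] at hge
  have hre : r ≤ e := by linarith
  have he0 : 0 < e := by linarith
  obtain ⟨f, hfd, hf1, hAf⟩ := hpos.exists_eigenvector he0 hsr (by linarith)
  have hint : ∫ x, BV.toL1 f x = 1 := by rw [hfd.integral_eq, hf1, Complex.ofReal_one]
  have hPf : openTransfer hT hH (BV.toL1 f) = (e : ℂ) • BV.toL1 f := by
    rw [← toL1_openTransferBV hT hA hH, hAf, map_smul]
  have hfH := integral_openTransfer hT hH (BV.toL1 f)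
  rw [hPf, hint] at hfH
  have hsm := setIntegral_smul_L1 (e : ℂ) (BV.toL1 f) univ
  rw [setIntegral_univ, setIntegral_univ, hint, mul_one] at hsm
  rw [hsm] at hfH
  have hre0 : ∀ᵐ x, 0 ≤ (BV.toL1 f x).re := hfd.ae_nonneg.mono fun x hx => hx.1
  have hfHre : e = 1 - ∫ x in H, (BV.toL1 f x).re := by
    rw [setIntegral_re]
    simpa using congrArg Complex.re hfH
  have hHnn : 0 ≤ ∫ x in H, (BV.toL1 f x).re :=
    integral_nonneg_of_ae (ae_restrict_of_ae hre0)
  have hf0 : f ≠ 0 := by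
    rintro rfl
    simp at hf1
  have hden : IsDensity (BV.toL1 f) := ⟨hfd.ae_nonneg, hint⟩
  refine ⟨e, f, he0, by linarith, ⟨Module.End.mem_eigenspace_iff.2 hAf, hf0⟩, hsr, hden, ?_,
    by linarith⟩
  rcases lt_or_ge e 1 with h1 | h1
  · exact Or.inl ⟨hden, he0, h1, hPf⟩
  · have he1 : e = 1 := by linarith
    have hzero : ∫ x in H, (BV.toL1 f x).re = 0 := by linarith
    rw [integral_eq_zero_iff_of_nonneg_ae (ae_restrict_of_ae hre0)
      (L1.integrable _).re.integrableOn] at hzero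
    have hz : ∀ᵐ x, x ∈ H → BV.toL1 f x = 0 := by
      have := (ae_restrict_iff' hH.measurableSet).1 hzero
      filter_upwards [this, hfd.ae_nonneg] with x hx h0 hxH
      exact Complex.ext (hx hxH) h0.2
    refine Or.inr ⟨he1, ?_, hz⟩
    have hcut : cutoff hH.measurableSet.compl (BV.toL1 f) = BV.toL1 f := by
      apply Lp.ext
      filter_upwards [cutoff_coe hH.measurableSet.compl (BV.toL1 f), hz] with x hx h0
      rw [hx]
      by_cases hxH : x ∈ H
      · rw [h0 hxH, indicator_of_notMem (by simpa using hxH)]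
      · rw [indicator_of_mem (by simpa using hxH)]
    rw [openTransfer, ContinuousLinearMap.comp_apply, hcut, he1, Complex.ofReal_one,
      one_smul] at hPf
    exact hPf

end OpenSystem

/-! ### The resolvent of Ulam's approximation -/

/-- The resolvent is bounded at any positive distance from the spectrum. -/
lemma exists_norm_resolvent_le {𝔸 : Type*} [NormedRing 𝔸] [NormedAlgebra ℂ 𝔸] [CompleteSpace 𝔸]
    (x : 𝔸) {δ : ℝ} (hδ : 0 < δ) :
    ∃ M : ℝ, ∀ z, δ ≤ Metric.infDist z (spectrum ℂ x) → ‖resolvent x z‖ ≤ M := by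
  have h1 : ∀ᶠ z in Bornology.cobounded ℂ, ‖resolvent x z‖ < 1 := by
    have := (spectrum.resolvent_tendsto_cobounded (𝕜 := ℂ) x).norm
    rw [norm_zero] at this
    exact this.eventually_lt_const one_pos
  obtain ⟨R, -, hR⟩ := (hasBasis_cobounded_norm (E := ℂ)).eventually_iff.1 h1
  have hcl : IsClosed {z : ℂ | δ ≤ Metric.infDist z (spectrum ℂ x)} :=
    isClosed_le continuous_const (Metric.continuous_infDist_pt _)
  have hcomp := (isCompact_closedBall (0 : ℂ) R).inter_right hcl
  obtain ⟨M, hM⟩ := hcomp.exists_bound_of_continuousOn (f := resolvent x) fun z hz => by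
    have hzr : z ∈ resolventSet ℂ x := by
      by_contra hzs
      have h0 : Metric.infDist z (spectrum ℂ x) = 0 := Metric.infDist_zero_of_mem hzs
      have h2 := hz.2
      rw [mem_ofPred_eq, h0] at h2
      linarith
    exact (spectrum.hasDerivAt_resolvent_const_left hzr).continuousAt.continuousWithinAt
  refine ⟨max M 1, fun z hz => ?_⟩
  rcases le_or_gt ‖z‖ R with h | h
  · exact (hM z ⟨by simpa using h, hz⟩).trans (le_max_left _ _)
  · exact (hR h.le).le.trans (le_max_right _ _)

section Ulam

variable {T : unitInterval → unitInterval} (hT : Measure.QuasiMeasurePreserving T volume volume)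
  (η : IntervalPartition)

lemma IntervalPartition.sum_setIntegral {E : Type*} [NormedAddCommGroup E] [NormedSpace ℝ E]
    {f : unitInterval → E} (hf : Integrable f volume) :
    ∑ J : η.toFinpartition.parts, ∫ x in J.1, f x = ∫ x, f x := by
  rw [← integral_iUnion_fintype (s := fun J : η.toFinpartition.parts => (J : Set unitInterval))
    (fun J => (η.ordConnected J.1 J.2).measurableSet)
    (fun J K hJK => η.toFinpartition.disjoint J.2 K.2 (Subtype.coe_injective.ne hJK))
    fun J => hf.integrableOn]
  have h : (⋃ J : η.toFinpartition.parts, (J : Set unitInterval)) = univ := by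
    have h1 := η.toFinpartition.sup_parts
    rw [Finset.sup_id_set_eq_sUnion, sUnion_eq_iUnion] at h1
    exact h1
  rw [h, setIntegral_univ]

lemma toL1_ulamProj (f : L1) : BV.toL1 (ulamProj η f) = ∑ J : η.toFinpartition.parts,
    (((volume.real J.1)⁻¹ : ℝ) : ℂ) • (∫ x in J.1, f x) •
      BV.toL1 (bvIndicator J.1 (η.ordConnected J.1 J.2)) := by
  rw [ulamProj, sum_apply, map_sum]
  rfl

lemma toL1_bvIndicator {J : Set unitInterval} (hJ : J.OrdConnected) :
    BV.toL1 (bvIndicator J hJ)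
      = indicatorConstLp 1 hJ.measurableSet (measure_ne_top _ _) (1 : ℂ) := rfl

/-- Elements of measure zero, for which `(λ J)⁻¹ = 0`, do no harm. -/
lemma inv_mul_measureReal_mul_setIntegral (J : Set unitInterval) (f : L1) :
    (((volume.real J)⁻¹ : ℝ) : ℂ) * ((∫ x in J, f x) * ((volume.real J : ℝ) : ℂ))
      = ∫ x in J, f x := by
  by_cases h : volume.real J = 0
  · rw [measureReal_eq_zero_iff] at h
    rw [Measure.restrict_eq_zero.2 h, integral_zero_measure, zero_mul, mul_zero]
  · rw [mul_comm, mul_assoc, ← Complex.ofReal_mul, mul_inv_cancel₀ h, Complex.ofReal_one, mul_one]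

lemma integral_ulamProj (f : L1) : ∫ x, BV.toL1 (ulamProj η f) x = ∫ x, f x := by
  have h : ∀ g : L1, ∫ x, g x = setIntegralCLM univ g := fun g => (setIntegral_univ).symm
  rw [h, toL1_ulamProj, map_sum, ← η.sum_setIntegral (L1.integrable f)]
  refine Finset.sum_congr rfl fun J _ => ?_
  rw [map_smul, map_smul, ← h, toL1_bvIndicator, integral_indicatorConstLp, smul_eq_mul,
    smul_eq_mul, Complex.real_smul, mul_one, inv_mul_measureReal_mul_setIntegral]

lemma norm_toL1_ulamProj_le (f : L1) : ‖BV.toL1 (ulamProj η f)‖ ≤ ‖f‖ := by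
  rw [toL1_ulamProj, L1.norm_eq_integral_norm f, ← η.sum_setIntegral (L1.integrable f).norm]
  refine (norm_sum_le _ _).trans (Finset.sum_le_sum fun J _ => ?_)
  have h1 : ‖BV.toL1 (bvIndicator J.1 (η.ordConnected J.1 J.2))‖ = ‖((volume.real J.1 : ℝ) : ℂ)‖ := by
    rw [toL1_bvIndicator, norm_indicatorConstLp one_ne_zero ENNReal.one_ne_top]
    simp [abs_of_nonneg measureReal_nonneg]
  rw [norm_smul, norm_smul, h1, ← norm_mul, ← norm_mul, inv_mul_measureReal_mul_setIntegral]
  exact norm_integral_le_integral_norm _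

lemma ulam_apply (f : BV) : ulam hT η f
    = ulamProj η (transfer hT (BV.toL1 (ulamProj η (BV.toL1 f)))) := rfl

lemma integral_ulam (f : BV) : ∫ x, BV.toL1 (ulam hT η f) x = ∫ x, BV.toL1 f x := by
  rw [ulam_apply, integral_ulamProj, integral_transfer, integral_ulamProj]

lemma norm_toL1_ulam_le (f : BV) : ‖BV.toL1 (ulam hT η f)‖ ≤ ‖BV.toL1 f‖ := by
  rw [ulam_apply]
  exact (norm_toL1_ulamProj_le η _).trans ((norm_transfer_le hT _).trans (norm_toL1_ulamProj_le η _))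

lemma norm_ulam_le (f : BV) : ‖ulam hT η f‖ ≤ ‖ulamProj η‖ * ‖BV.toL1 f‖ := by
  rw [ulam_apply]
  refine ((ulamProj η).le_opNorm _).trans (mul_le_mul_of_nonneg_left ?_ (norm_nonneg _))
  exact (norm_transfer_le hT _).trans (norm_toL1_ulamProj_le η _)

lemma norm_toL1_ulam_pow_le (n : ℕ) (f : BV) : ‖BV.toL1 ((ulam hT η ^ n) f)‖ ≤ ‖BV.toL1 f‖ := by
  induction n with
  | zero => simp
  | succ n ih =>
    rw [pow_succ', mul_apply_eq_comp]
    exact (norm_toL1_ulam_le hT η _).trans ih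

/-- All powers of `P_η` are bounded by `‖Π_η‖`, as `P_η` contracts `L¹` and maps it to `BV`. -/
lemma norm_le_one_of_mem_spectrum_ulam {z : ℂ} (hz : z ∈ spectrum ℂ (ulam hT η)) : ‖z‖ ≤ 1 := by
  by_contra! h
  obtain ⟨n, hn⟩ := pow_unbounded_of_one_lt ‖ulamProj η‖ h
  have h1 : ‖z ^ (n + 1)‖ ≤ ‖ulam hT η ^ (n + 1)‖ :=
    spectrum.norm_le_norm_of_mem (spectrum.pow_mem_pow _ _ hz)
  have h2 : ‖ulam hT η ^ (n + 1)‖ ≤ ‖ulamProj η‖ := by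
    refine ContinuousLinearMap.opNorm_le_bound _ (norm_nonneg _) fun f => ?_
    rw [pow_succ', mul_apply_eq_comp]
    refine (norm_ulam_le hT η _).trans (mul_le_mul_of_nonneg_left ?_ (norm_nonneg _))
    exact (norm_toL1_ulam_pow_le hT η n f).trans (BV.norm_toL1_le f)
  rw [norm_pow, pow_succ] at h1
  have h3 : ‖z‖ ^ n ≤ ‖z‖ ^ n * ‖z‖ := le_mul_of_one_le_right (by positivity) h.le
  linarith

lemma integral_resolvent_ulam {z : ℂ} (hz : z ∈ resolventSet ℂ (ulam hT η)) (f : BV) :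
    (z - 1) * ∫ x, BV.toL1 (resolvent (ulam hT η) z f) x = ∫ x, BV.toL1 f x := by
  have h1 : z • resolvent (ulam hT η) z f = f + ulam hT η (resolvent (ulam hT η) z f) := by
    simpa using congrArg (fun B : BV →L[ℂ] BV => B f) (smul_resolvent hz)
  have h : ∀ g : L1, ∫ x, g x = setIntegralCLM univ g := fun g => (setIntegral_univ).symm
  have h2 := congrArg (fun g => setIntegralCLM univ (BV.toL1 g)) h1
  simp only [map_smul, map_add] at h2
  rw [← h, ← h, ← h, integral_ulam, smul_eq_mul] at h2
  rw [sub_mul, one_mul, h2, add_sub_cancel_right]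

lemma one_mem_spectrum_ulam : (1 : ℂ) ∈ spectrum ℂ (ulam hT η) := by
  intro h
  have := integral_resolvent_ulam hT η h BV.one
  rw [sub_self, zero_mul, BV.integral_one] at this
  exact zero_ne_one this

/-- The set whose supremum is `H*` is bounded above, although the resolvent is measured from `L¹` to
`L¹`: in `z (z - P_η)⁻¹ v = v + (z - P_η)⁻¹ P_η v`, the operator `P_η` is bounded from `L¹` to `BV`. -/
lemma bddAbove_Hstar_ulam {α₀ B₀ δ r : ℝ} (hδ : 0 < δ) (hr : 0 < r) (hrα : α₀ < r)
    (hB₀ : 0 ≤ B₀) :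
    BddAbove {x | ∃ (z : ℂ) (v : BV), z ∉ Vset (ulam hT η) δ r ∧ ‖BV.toL1 v‖ = 1 ∧
      x = (B₀ / (r - α₀) + 1) * ‖BV.toL1 (resolvent (ulam hT η) z v)‖ + 1 / (r - α₀) + 2 / r} := by
  obtain ⟨M, hM⟩ := exists_norm_resolvent_le (ulam hT η) hδ
  refine ⟨(B₀ / (r - α₀) + 1) * (r⁻¹ * (1 + M * ‖ulamProj η‖)) + 1 / (r - α₀) + 2 / r, ?_⟩
  rintro _ ⟨z, v, hz, hv, rfl⟩
  rw [Vset, mem_ofPred_eq, not_or, not_le, not_le] at hz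
  obtain ⟨hzr, hzδ⟩ := hz
  have hres : z ∈ resolventSet ℂ (ulam hT η) := by
    by_contra hzs
    have h0 : Metric.infDist z (spectrum ℂ (ulam hT η)) = 0 := Metric.infDist_zero_of_mem hzs
    linarith
  have hz0 : 0 < ‖z‖ := hr.trans hzr
  have h1 : z • resolvent (ulam hT η) z v = v + resolvent (ulam hT η) z (ulam hT η v) := by
    have h : resolvent (ulam hT η) z * (algebraMap ℂ (BV →L[ℂ] BV) z - ulam hT η) = 1 :=
      Ring.inverse_mul_cancel _ hres
    rw [mul_sub, Algebra.algebraMap_eq_smul_one, mul_smul_comm, mul_one, sub_eq_iff_eq_add] at h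
    simpa using congrArg (fun B : BV →L[ℂ] BV => B v) h
  have h2 : ‖z‖ * ‖BV.toL1 (resolvent (ulam hT η) z v)‖ ≤ 1 + M * ‖ulamProj η‖ := by
    rw [← norm_smul, ← map_smul, h1, map_add]
    refine (norm_add_le _ _).trans (add_le_add hv.le ?_)
    refine (BV.norm_toL1_le _).trans (((resolvent (ulam hT η) z).le_opNorm _).trans ?_)
    have h3 := norm_ulam_le hT η v
    rw [hv, mul_one] at h3
    exact mul_le_mul (hM z hzδ.le) h3 (norm_nonneg _) ((norm_nonneg _).trans (hM z hzδ.le))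
  have h4 : ‖BV.toL1 (resolvent (ulam hT η) z v)‖ ≤ r⁻¹ * (1 + M * ‖ulamProj η‖) := by
    rw [← div_eq_inv_mul, le_div_iff₀ hr, mul_comm]
    exact (mul_le_mul_of_nonneg_right hzr.le (norm_nonneg _)).trans h2
  have h5 : 0 ≤ B₀ / (r - α₀) + 1 := by
    have : 0 < r - α₀ := by linarith
    positivity
  gcongr

/-- A lower bound for `H*` from the point `z = 1 + t` and the function `v = 1`, for which the integral of
`(z - P_η)⁻¹ v` is `1 / t`. -/
lemma le_Hstar_ulam {α₀ B₀ δ r t : ℝ} (hδ : 0 < δ) (hr : 0 < r) (hr1 : r < 1) (hrα : α₀ < r)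
    (hB₀ : 0 ≤ B₀) (ht : δ < t) :
    (B₀ / (r - α₀) + 1) / t + 1 / (r - α₀) + 2 / r ≤ Hstar (ulam hT η) α₀ B₀ δ r := by
  have ht0 : 0 < t := hδ.trans ht
  set z : ℂ := ((1 + t : ℝ) : ℂ) with hz
  have hzn : ‖z‖ = 1 + t := by rw [hz, Complex.norm_real, Real.norm_of_nonneg (by positivity)]
  have hdist : t ≤ Metric.infDist z (spectrum ℂ (ulam hT η)) := by
    rw [Metric.le_infDist ⟨1, one_mem_spectrum_ulam hT η⟩]
    intro w hw
    have h1 := norm_le_one_of_mem_spectrum_ulam hT η hw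
    have h2 := norm_sub_norm_le z w
    rw [dist_eq_norm]
    linarith
  have hres : z ∈ resolventSet ℂ (ulam hT η) := by
    by_contra hzs
    have := norm_le_one_of_mem_spectrum_ulam hT η hzs
    linarith
  have hV : z ∉ Vset (ulam hT η) δ r := by
    rw [Vset, mem_ofPred_eq, not_or, not_le, not_le]
    exact ⟨by linarith, ht.trans_le hdist⟩
  refine le_csSup_of_le (bddAbove_Hstar_ulam hT η hδ hr hrα hB₀)
    ⟨z, BV.one, hV, BV.norm_toL1_one, rfl⟩ ?_
  have h1 := integral_resolvent_ulam hT η hres BV.one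
  have hz1 : z - 1 = (t : ℂ) := by rw [hz]; push_cast; ring
  rw [hz1, BV.integral_one] at h1
  have h2 : 1 ≤ t * ‖BV.toL1 (resolvent (ulam hT η) z BV.one)‖ := by
    have h3 := congrArg norm h1
    rw [norm_mul, Complex.norm_real, Real.norm_of_nonneg ht0.le, norm_one] at h3
    rw [← h3, L1.norm_eq_integral_norm]
    exact mul_le_mul_of_nonneg_left (norm_integral_le_integral_norm _) ht0.le
  have h5 : 0 ≤ B₀ / (r - α₀) + 1 := by
    have : 0 < r - α₀ := by linarith
    positivity
  have h6 : (B₀ / (r - α₀) + 1) / t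
      ≤ (B₀ / (r - α₀) + 1) * ‖BV.toL1 (resolvent (ulam hT η) z BV.one)‖ := by
    rw [div_eq_mul_inv]
    refine mul_le_mul_of_nonneg_left ?_ h5
    rwa [inv_le_iff_one_le_mul₀' ht0]
  linarith

/-- The limit `t ↓ δ` of `le_Hstar_ulam`. -/
lemma le_Hstar_ulam_div {α₀ B₀ δ r : ℝ} (hδ : 0 < δ) (hr : 0 < r) (hr1 : r < 1) (hrα : α₀ < r)
    (hB₀ : 0 ≤ B₀) :
    (B₀ / (r - α₀) + 1) / δ + 1 / (r - α₀) + 2 / r ≤ Hstar (ulam hT η) α₀ B₀ δ r := by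
  have hlim : Tendsto (fun t : ℝ => (B₀ / (r - α₀) + 1) / t + 1 / (r - α₀) + 2 / r) (𝓝[>] δ)
      (𝓝 ((B₀ / (r - α₀) + 1) / δ + 1 / (r - α₀) + 2 / r)) :=
    (((tendsto_const_nhds.div (tendsto_nhdsWithin_of_tendsto_nhds tendsto_id) hδ.ne').add_const
      _).add_const _)
  refine le_of_tendsto hlim ?_
  filter_upwards [self_mem_nhdsWithin] with t ht
  exact le_Hstar_ulam hT η hδ hr hr1 hrα hB₀ ht

end Ulam

/-! ### The size of the admissible holes -/

/-- With `L = ln (r / a)` and `u = -ln r`, the hypothesis gives `r ^ N ≤ r e ^ (-u / L) ≤ r L / (L + u)`,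
while `1 - a ≤ L + u` and `a L ≤ r - a`. -/
lemma zpow_mul_sq_lt {r a : ℝ} {N : ℤ} (ha : 0 < a) (har : a < r) (hr : r < 1)
    (hN : 1 + 1 / Real.log (r / a) ≤ N) : r ^ N * (1 - a) ^ 2 < 64 / 9 * (r - a) := by
  have hr0 : 0 < r := ha.trans har
  set L := Real.log (r / a) with hL
  have hL0 : 0 < L := Real.log_pos ((one_lt_div ha).2 har)
  set u := -Real.log r with hu
  have hu0 : 0 < u := neg_pos.2 (Real.log_neg hr0 hr)
  have hLu : 1 - a ≤ L + u := by
    have h1 := Real.log_le_sub_one_of_pos ha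
    rw [hL, hu, Real.log_div hr0.ne' ha.ne']
    linarith
  have hpow : r ^ N ≤ r * (L / (L + u)) := by
    have e : r ^ N = r * r ^ (N - 1) := by
      rw [zpow_sub_one₀ hr0.ne']; field_simp
    rw [e]
    refine mul_le_mul_of_nonneg_left ?_ hr0.le
    have h1 : r ^ (N - 1) = Real.exp (-(((N : ℝ) - 1) * u)) := by
      rw [← Real.rpow_intCast, Real.rpow_def_of_pos hr0, hu]
      push_cast
      congr 1
      ring
    have h2 : u / L ≤ ((N : ℝ) - 1) * u := by
      rw [div_eq_inv_mul, ← one_div]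
      exact mul_le_mul_of_nonneg_right (by linarith) hu0.le
    have h3 : 1 + u / L ≤ Real.exp (u / L) := by linarith [Real.add_one_le_exp (u / L)]
    calc r ^ (N - 1) ≤ Real.exp (-(u / L)) := by
          rw [h1]; exact Real.exp_le_exp.2 (by linarith)
      _ = (Real.exp (u / L))⁻¹ := Real.exp_neg _
      _ ≤ (1 + u / L)⁻¹ := inv_anti₀ (by positivity) h3
      _ = L / (L + u) := by field_simp
  have hpow0 : 0 < r ^ N := zpow_pos hr0 _
  have h1a : 0 < 1 - a := by linarith
  have hLu0 : 0 < L + u := by positivity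
  rcases le_or_gt r (7 * a) with h | h
  · have h1 : a * L ≤ r - a := by
      have := Real.log_le_sub_one_of_pos (div_pos hr0 ha)
      calc a * L ≤ a * (r / a - 1) := mul_le_mul_of_nonneg_left this ha.le
        _ = r - a := by field_simp
    calc r ^ N * (1 - a) ^ 2 ≤ r * (L / (L + u)) * ((L + u) * 1) := by
          rw [sq]
          refine mul_le_mul hpow (mul_le_mul hLu (by linarith) h1a.le hLu0.le) (by positivity)
            (by positivity)
      _ = r * L := by field_simp
      _ ≤ 7 * a * L := mul_le_mul_of_nonneg_right h hL0.le
      _ < 64 / 9 * (r - a) := by linarith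
  · have h1 : r ^ N ≤ r := hpow.trans
      (mul_le_of_le_one_right hr0.le ((div_le_one hLu0).2 (by linarith)))
    have h2 : (1 - a) ^ 2 ≤ 1 := by nlinarith
    calc r ^ N * (1 - a) ^ 2 ≤ r * 1 := mul_le_mul h1 h2 (by positivity) hr0.le
      _ < 64 / 9 * (r - a) := by linarith

/-- A hole of size `m ≤ ε₀* / 2` satisfies the smallness condition for the cone argument. Besides the
lower bound on `H*`, only `n₁ ≥ 1`, `n₂ ≥ 1 / ln (r / α)` and the first term of `ε₀*` matter. -/
lemma hole_bound_lt {A : BV →L[ℂ] BV} {α₀ B₀ δ r m : ℝ} (hα₀ : 0 < α₀) (hB₀ : 0 ≤ B₀)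
    (hr : 3 * α₀ < r) (hr1 : r < 1) (hδ : 0 < δ) (hδ1 : δ ≤ 1)
    (hh : (B₀ / (r - α₀) + 1) / δ ≤ Hstar A α₀ B₀ δ r) (hm : m ≤ epsStar A α₀ B₀ δ r / 2) :
    (1 + (2 * α₀ + B₀) / (r - 3 * α₀)) * m < δ := by
  have hr0 : 0 < r := by linarith
  have hra : 0 < r - 3 * α₀ := by linarith
  have hra0 : 0 < r - α₀ := by linarith
  have h1a : 0 < 1 - 3 * α₀ := by linarith
  set h := Hstar A α₀ B₀ δ r
  set B := (1 - α₀ + B₀) / (1 - 3 * α₀) with hB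
  have hB1 : 1 ≤ B := by rw [hB, le_div_iff₀ h1a]; linarith
  have hB2 : 2 / 3 ≤ B * (1 - 3 * α₀) := by rw [hB, div_mul_cancel₀ _ h1a.ne']; linarith
  set L := Real.log (r / (3 * α₀)) with hL
  have hL0 : 0 < L := Real.log_pos ((one_lt_div (by positivity)).2 hr)
  set n₁ : ℤ := ⌈Real.log 2 / L⌉ with hn₁
  have hn₁1 : 1 ≤ n₁ := Int.one_le_ceil_iff.2 (div_pos (Real.log_pos (by norm_num)) hL0)
  set n₂ : ℤ := ⌈Real.log (8 * B * (3 + B) * r ^ (-n₁) * h) / L⌉ with hn₂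
  have heps : epsStar A α₀ B₀ δ r ≤ r ^ (n₁ + n₂) / (8 * B * (h * B + (1 - r)⁻¹)) :=
    min_le_left _ _
  have hC : 1 ≤ r ^ (-n₁) := by
    rw [zpow_neg]
    exact (one_le_inv₀ (zpow_pos hr0 _)).2 (zpow_le_one₀ hr0 hr1.le (by linarith))
  have hh0 : B₀ / (r - α₀) + 1 ≤ h * δ := (div_le_iff₀ hδ).1 hh
  have hBr : 0 ≤ B₀ / (r - α₀) := by positivity
  have hh1 : 1 ≤ h := by
    have h1 : 1 ≤ (B₀ / (r - α₀) + 1) / δ := by rw [le_div_iff₀ hδ]; linarith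
    exact h1.trans hh
  have hn₂1 : 1 / L ≤ n₂ := by
    refine le_trans ?_ (Int.le_ceil _)
    refine div_le_div_of_nonneg_right ?_ hL0.le
    -- `8 B D C H* ≥ 32 > e`, where `D = 3 + B ≥ 4`.
    rw [Real.le_log_iff_exp_le (by positivity)]
    have h1 : 1 ≤ B * (3 + B) := by nlinarith
    have h2 : 1 ≤ B * (3 + B) * (r ^ (-n₁) * h) := one_le_mul_of_one_le_of_one_le h1
      (one_le_mul_of_one_le_of_one_le hC hh1)
    have h3 := Real.exp_one_lt_d9
    linarith
  have hN : 1 + 1 / L ≤ ((n₁ + n₂ : ℤ) : ℝ) := by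
    push_cast
    have : (1 : ℝ) ≤ n₁ := by exact_mod_cast hn₁1
    linarith
  have key := zpow_mul_sq_lt (by positivity) hr hr1 hN
  set P := r ^ (n₁ + n₂)
  have hP0 : 0 < P := zpow_pos hr0 _
  -- The summand `(1 - r)⁻¹` of the denominator is positive and can be dropped.
  have hm' : m ≤ P / (16 * B ^ 2 * h) := by
    refine hm.trans ?_
    have h1 : P / (8 * B * (h * B + (1 - r)⁻¹)) ≤ P / (8 * B ^ 2 * h) := by
      refine div_le_div_of_nonneg_left hP0.le (by positivity) ?_
      have : 0 < (1 - r)⁻¹ := inv_pos.2 (by linarith)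
      nlinarith
    calc epsStar A α₀ B₀ δ r / 2 ≤ P / (8 * B ^ 2 * h) / 2 := by linarith
      _ = P / (16 * B ^ 2 * h) := by rw [div_div]; congr 1; ring
  have hP : P * (r - α₀) < 16 * B ^ 2 * (r - 3 * α₀) := by
    have h1 : 4 / 9 ≤ B ^ 2 * (1 - 3 * α₀) ^ 2 := by nlinarith
    have h2 : P * (1 - 3 * α₀) ^ 2 < 16 * B ^ 2 * (r - 3 * α₀) * (1 - 3 * α₀) ^ 2 := by
      nlinarith
    have h3 := lt_of_mul_lt_mul_right h2 (by positivity)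
    nlinarith
  have hK : 1 + (2 * α₀ + B₀) / (r - 3 * α₀)
      = (B₀ / (r - α₀) + 1) * ((r - α₀) / (r - 3 * α₀)) := by
    rw [one_add_div hra.ne', div_add_one hra0.ne', div_mul_div_cancel₀ hra0.ne']
    congr 1
    ring
  calc (1 + (2 * α₀ + B₀) / (r - 3 * α₀)) * m
      ≤ (1 + (2 * α₀ + B₀) / (r - 3 * α₀)) * (P / (16 * B ^ 2 * h)) := by
        gcongr
    _ ≤ h * δ * ((r - α₀) / (r - 3 * α₀)) * (P / (16 * B ^ 2 * h)) := by
        rw [hK]; gcongr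
    _ = δ * ((P * (r - α₀)) / (16 * B ^ 2 * (r - 3 * α₀))) := by
        field_simp
    _ < δ * 1 := by
        refine mul_lt_mul_of_pos_left ?_ hδ
        rwa [div_lt_one (by positivity)]
    _ = δ := mul_one δ

/-- Along a run of the algorithm, `δ = 1 / k` stays below `ℓ`. -/
lemma Reaches.inv_lt {T : unitInterval → unitInterval}
    {hT : Measure.QuasiMeasurePreserving T volume volume} {α₀ B₀ ℓ : ℝ} {k : ℕ}
    {η : IntervalPartition} (h : Reaches hT α₀ B₀ ℓ k η) : 0 < k ∧ 1 / (k : ℝ) < ℓ := by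
  induction h with
  | start k η hk hkl => exact ⟨hk, hkl⟩
  | refine k η η' _ _ _ ih => exact ih
  | double k η _ _ _ ih =>
    refine ⟨by omega, lt_of_le_of_lt ?_ ih.2⟩
    have : (0 : ℝ) < k := by exact_mod_cast ih.1
    push_cast
    exact one_div_le_one_div_of_le this (by linarith)

end

end AccimUlam

theorem theorem5p3 (T : unitInterval → unitInterval)
    (hT : Measure.QuasiMeasurePreserving T volume volume)
    (α₀ B₀ : ℝ) (hα₀ : 0 < α₀) (hB₀ : 0 ≤ B₀) (hA : LasotaYorke hT α₀ B₀)
    (ℓ : ℝ) (hℓ : 0 < ℓ) (hℓα : ℓ < 1 - 3 * α₀)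
    (εcom δcom : ℝ) (hout : IsOutput hT α₀ B₀ ℓ εcom δcom)
    (H : Set unitInterval) (hHo : IsOpen H) (hH : H.OrdConnected)
    (hsize : volume.real H ≤ Gam α₀ B₀ * εcom) :
    ∃ (e : ℝ) (f : BV),
      -- `e > 0` is an eigenvalue of `P_H` on `BV`, equal to its spectral radius, with the
      -- eigenfunction `f`, a probability density
      0 < e ∧ e ≤ 1 ∧
      Module.End.HasEigenvector (openTransferBV hT hA hH : BV →ₗ[ℂ] BV) (e : ℂ) f ∧
      spectralRadius ℂ (openTransferBV hT hA hH) = ENNReal.ofReal e ∧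
      IsDensity (BV.toL1 f) ∧
      -- `f` is the density of an accim, unless no mass escapes
      (IsAccimDensity hT hH e (BV.toL1 f) ∨
        (e = 1 ∧ transfer hT (BV.toL1 f) = BV.toL1 f ∧ ∀ᵐ x, x ∈ H → BV.toL1 f x = 0)) ∧
      1 - e < δcom ∧
      1 - e ≤ (1 + (2 * α₀ + B₀) / (1 - ℓ - 3 * α₀)) * volume.real H := by
  obtain ⟨k, η, hreach, hmesh, -, rfl, rfl⟩ := hout
  obtain ⟨hk, hkl⟩ := hreach.inv_lt
  have hδ : (0 : ℝ) < 1 / (k : ℝ) := by positivity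
  have hr : 3 * α₀ < 1 - ℓ := by linarith
  have hr0 : 0 < 1 - ℓ := by linarith
  have hΓ : 0 < Gam α₀ B₀ := lt_of_lt_of_le (by linarith) (le_max_left _ _)
  have hh : (B₀ / (1 - ℓ - α₀) + 1) / (1 / (k : ℝ))
      ≤ Hstar (ulam hT η) α₀ B₀ (1 / (k : ℝ)) (1 - ℓ) := by
    have h1 := le_Hstar_ulam_div hT η hδ hr0 (by linarith) (by linarith : α₀ < 1 - ℓ) hB₀
    have h2 : 0 < 1 / (1 - ℓ - α₀) := one_div_pos.2 (by linarith)
    have h3 : 0 < 2 / (1 - ℓ) := by positivity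
    linarith
  have hm : volume.real H ≤ epsStar (ulam hT η) α₀ B₀ (1 / (k : ℝ)) (1 - ℓ) / 2 := by
    refine hsize.trans ((mul_le_mul_of_nonneg_left hmesh hΓ.le).trans (le_of_eq ?_))
    field_simp
  have hlt := hole_bound_lt hα₀ hB₀ hr (by linarith) hδ (by linarith) hh hm
  obtain ⟨e, f, he0, he1, hev, hsr, hden, hacc, hle⟩ :=
    exists_accim_of_small_hole hT hA hH hα₀.le hB₀ hr (by linarith)
  exact ⟨e, f, he0, he1, hev, hsr, hden, hacc, hle.trans_lt hlt, hle⟩
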